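/- Let $p\ge d\ge 1$ be integers and, for $q\ge d$, let $\mathrm{St}(q,d)=\{X\in\mathbb{R}^{d\times q}: XX^\top=I_d\}$; $\mathrm{St}(q,d)^{\otimes n}$ denotes the set of stacked matrices $S\in\mathbb{R}^{nd\times q}$ whose $n$ blocks $S_i$ lie in $\mathrm{St}(q,d)$, and $\mathrm{O}(d)=\mathrm{St}(d,d)$. For $A\in\mathbb{R}^{nd\times nd}$ consider the problem $$\min_{S\in \mathrm{St}(p,d)^{\otimes n}}\ -\langle A, SS^\top\rangle .\qquad (\ast)$$ A point $S$ is a second-order critical point of $(\ast)$ if the Riemannian gradient of the objective at $S$ vanishes and its Riemannian Hessian at $S$ is positive semidefinite; equivalently, along every smooth curve in $\mathrm{St}(p,d)^{\otimes n}$ passing through $S$ at time $0$, the first derivative of the objective at time $0$ is zero and the second derivative is nonnegative. Let $\mathrm{BDG}(X)$ denote the block-diagonal matrix with $d\times d$ diagonal blocks $(X_{ii}+X_{ii}^\top)/2$. For $Z\in\mathrm{O}(d)^{\otimes n}$ put $L=\mathrm{BDG}(AZZ^\top)-A$. Let $\lambda_k(L)$ and $\lambda_{\max}(L)$ be the $k$-th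 smallest (with multiplicity) and the largest eigenvalue of $L$. (a) Let $n\ge 2$, $A\in\mathbb{R}^{nd\times nd}$ and $Z\in\mathrm{O}(d)^{\otimes n}$ be such that $L\succeq 0$, $LZ=0$ and $\lambda_{d+1}(L)>0$. If $$\frac{\lambda_{\max}(L)}{\lambda_{d+1}(L)}<\frac{2p}{d+1},$$ then no $S\in\mathrm{St}(p,d)^{\otimes n}$ with $Z^\top S=0$ is a second-order critical point of $(\ast)$. (b) Conversely, let $n=2^dp$ and $Z\in\mathrm{O}(d)^{\otimes n}$. Let $M$ be the $p\times p$ cyclic permutation matrix with $M_{a,a+1}=1$ for $1\le a<p$ and $M_{p,1}=1$, let $D_1,\dots,D_{2^d}$ be the diagonal $d\times d$ matrices with diagonal entries $\pm1$, and list the $n$ matrices $D_j[I_d,0_{d\times(p-d)}]M^k$ ($1\le j\le 2^d$, $1\le k\le p$) as $T_1,\dots,T_n$. Let $S$ be the "twisted state" with blocks $S_i=Z_iT_i$ (so $S_i=T_i$ if all $Z_i=I_d$), and let $$L=\frac{2p}{d+1}\Big(I_{nd}-\frac1n ZZ^\top\Big)-\Big(\frac{2p}{d+1}-1\Big)\frac{p}{nd}SS^\top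 .$$ Then $S\in\mathrm{St}(p,d)^{\otimes n}$, $Z^\top S=0$, $L\succeq0$, $LZ=0$, $\lambda_{\max}(L)=\frac{2p}{d+1}$, $\lambda_{d+1}(L)=1$, and therefore $$\frac{\lambda_{\max}(L)}{\lambda_{d+1}(L)}=\frac{2p}{d+1}.$$ Moreover $L=\mathrm{BDG}(AZZ^\top)-A$ holds for $A=-L$, and for every $A$ with $\mathrm{BDG}(AZZ^\top)-A=L$ the point $S$ is a second-order critical point of $(\ast)$ while $Z$, viewed as the point of $\mathrm{St}(p,d)^{\otimes n}$ with blocks $[Z_i,0_{d\times(p-d)}]$, is a global minimizer of $(\ast)$, and every global minimizer $R$ of $(\ast)$ satisfies $RR^\top=ZZ^\top$. -/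

import Mathlib

open scoped Matrix ContDiff

namespace StiefelSync

/-- The `i`-th block (of size `d × q`) of a stacked matrix with `n` such blocks. -/
def block {n d q : ℕ} (S : Matrix (Fin n × Fin d) (Fin q) ℝ) (i : Fin n) :
    Matrix (Fin d) (Fin q) ℝ :=
  Matrix.of fun a b => S (i, a) b

/-- The product of Stiefel manifolds `St(q,d)^n`: stacked matrices whose blocks `S_i`, of size
`d × q`, satisfy `S_i S_iᵀ = I_d`. For `q = d` this is `O(d)^n`. -/
def Stiefel (n d q : ℕ) : Set (Matrix (Fin n × Fin d) (Fin q) ℝ) :=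
  {S | ∀ i, block S i * (block S i)ᵀ = 1}

/-- The Frobenius inner product `⟨X, Y⟩ = Tr(X Yᵀ)`. -/
def frob {m : Type*} [Fintype m] (X Y : Matrix m m ℝ) : ℝ := (X * Yᵀ).trace

/-- The objective function `S ↦ -⟨A, S Sᵀ⟩` of the Burer-Monteiro factorization. -/
def objective {n d q : ℕ} (A : Matrix (Fin n × Fin d) (Fin n × Fin d) ℝ)
    (S : Matrix (Fin n × Fin d) (Fin q) ℝ) : ℝ :=
  -frob A (S * Sᵀ)

/-- Symmetrize a matrix and keep its diagonal `d × d` blocks only. -/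
noncomputable def BDG {n d : ℕ} (X : Matrix (Fin n × Fin d) (Fin n × Fin d) ℝ) :
    Matrix (Fin n × Fin d) (Fin n × Fin d) ℝ :=
  Matrix.of fun x y => if x.1 = y.1 then (X x y + X y x) / 2 else 0

/-- The certificate matrix `L = BDG(A Z Zᵀ) - A` at `Z`. -/
noncomputable def certificate {n d : ℕ} (A : Matrix (Fin n × Fin d) (Fin n × Fin d) ℝ)
    (Z : Matrix (Fin n × Fin d) (Fin d) ℝ) : Matrix (Fin n × Fin d) (Fin n × Fin d) ℝ :=
  BDG (A * (Z * Zᵀ)) - A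

/-- `S` is a second-order critical point of `min { -⟨A, S Sᵀ⟩ : S ∈ St(q,d)^n }`: along every
smooth curve on the manifold that passes through `S` at time `0`, the first derivative of the
objective at time `0` vanishes and the second one is nonnegative. Equivalently, the Riemannian
gradient at `S` is zero and the Riemannian Hessian at `S` is positive semidefinite. -/
def IsSecondOrderCritical {n d q : ℕ} (A : Matrix (Fin n × Fin d) (Fin n × Fin d) ℝ)
    (S : Matrix (Fin n × Fin d) (Fin q) ℝ) : Prop :=
  S ∈ Stiefel n d q ∧
    ∀ c : ℝ → Matrix (Fin n × Fin d) (Fin q) ℝ,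
      (∀ x b, ContDiff ℝ ∞ fun t => c t x b) → (∀ t, c t ∈ Stiefel n d q) → c 0 = S →
        deriv (fun t => objective A (c t)) 0 = 0 ∧
          0 ≤ iteratedDeriv 2 (fun t => objective A (c t)) 0

open Classical in
/-- The `k`-th smallest eigenvalue, counted with multiplicity, of a real symmetric matrix of size
at least `k`, for `k ≥ 1` (and `0` in all other cases). Mathlib's `eigenvalues₀` lists the
eigenvalues in decreasing order. -/
noncomputable def kthEigenvalue {m : Type*} [Fintype m] [DecidableEq m] (L : Matrix m m ℝ)
    (k : ℕ) : ℝ :=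
  if h : L.IsHermitian ∧ 1 ≤ k ∧ k ≤ Fintype.card m then
    h.1.eigenvalues₀ ⟨Fintype.card m - k, by omega⟩
  else 0

/-- The largest eigenvalue of a real symmetric matrix. -/
noncomputable def maxEigenvalue {m : Type*} [Fintype m] [DecidableEq m] (L : Matrix m m ℝ) : ℝ :=
  kthEigenvalue L (Fintype.card m)

/-- The `d × p` matrix `[I_d, 0]`. -/
def frame (d p : ℕ) : Matrix (Fin d) (Fin p) ℝ :=
  Matrix.of fun a b => if (a : ℕ) = (b : ℕ) then 1 else 0

/-- The cyclic `p × p` permutation matrix: row `a` has its `1` in column `a + 1` modulo `p`. -/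
def cyclic (p : ℕ) : Matrix (Fin p) (Fin p) ℝ :=
  Matrix.of fun a b => if (b : ℕ) = ((a : ℕ) + 1) % p then 1 else 0

/-- The `j`-th diagonal sign matrix `diag(±1, …, ±1)` of size `d`; the `2 ^ d` sign patterns are
listed by the binary digits of `j`. -/
def signMatrix (d : ℕ) (j : Fin (2 ^ d)) : Matrix (Fin d) (Fin d) ℝ :=
  Matrix.diagonal fun a => (-1) ^ (finFunctionFinEquiv.symm j a : ℕ)

/-- The `d × p` blocks `D_j [I_d, 0] M ^ k`, `1 ≤ j ≤ 2 ^ d`, `1 ≤ k ≤ p`, listed as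
`n = 2 ^ d * p` blocks. -/
def twistedBlock (d p : ℕ) (i : Fin (2 ^ d * p)) : Matrix (Fin d) (Fin p) ℝ :=
  signMatrix d (finProdFinEquiv.symm i).1 * frame d p *
    cyclic p ^ (((finProdFinEquiv.symm i).2 : ℕ) + 1)

/-- The twisted state relative to `Z ∈ O(d)^n`: its `i`-th block is `Z_i` times the `i`-th
twisted block. -/
def twistedState {d p : ℕ} (Z : Matrix (Fin (2 ^ d * p) × Fin d) (Fin d) ℝ) :
    Matrix (Fin (2 ^ d * p) × Fin d) (Fin p) ℝ :=
  Matrix.of fun x b => (block Z x.1 * twistedBlock d p x.1) x.2 b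

/-- The matrix
`L = (2p/(d+1)) (I - Z Zᵀ / n) - (2p/(d+1) - 1) (p/(nd)) S Sᵀ`. -/
noncomputable def twistedLaplacian {n d p : ℕ} (Z : Matrix (Fin n × Fin d) (Fin d) ℝ)
    (S : Matrix (Fin n × Fin d) (Fin p) ℝ) : Matrix (Fin n × Fin d) (Fin n × Fin d) ℝ :=
  (2 * (p : ℝ) / ((d : ℝ) + 1)) • (1 - (n : ℝ)⁻¹ • (Z * Zᵀ)) -
    ((2 * (p : ℝ) / ((d : ℝ) + 1) - 1) * ((p : ℝ) / ((n : ℝ) * (d : ℝ)))) • (S * Sᵀ)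

end StiefelSync

namespace StiefelSync

/-! On the product of Stiefel manifolds the diagonal blocks of `S Sᵀ` are identities, so the
objective is `Tr(Sᵀ L S)` up to a constant (`objective_eq`). Everything is then a question about the
quadratic form of `L`.

Part (a) averages the second variation over test directions. For each matrix unit `E`, project `Z E`
onto the tangent space at `S` and follow a curve `S_i exp(t Ω_i)` in the resulting direction `V`.
Because `L Z = 0`, any multiple of `Z E` can be removed from `V` without changing `Tr(Vᵀ L V)`. What
remains is, up to sign, a matrix `R` whose form is at most `λ_max ‖R‖²`. Summed over all `E`, the
accelerations give `-(p - (d+1)/2) S` and the `‖R‖²` give `nd · (d+1)/2 · (1 - (d+1)/(2p))`, once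
the removed multiple is optimal. This is `second_order_inequality`: after division by `p - (d+1)/2`
it reads `Tr(Sᵀ L S) ≤ λ_max · nd(d+1)/(2p)`. If `Zᵀ S = 0`, the left side is at least `λ_{d+1} ·
nd`, which contradicts the bound on the ratio.

Part (b) is the equality case. Put `c = 2p/(d+1)`. The columns of `Z` and of `S` are orthogonal
families of constant length, so `L = c (I - P_Z - P_S) + P_S` with orthogonal projectors `P_Z`,
`P_S`; this gives the spectrum, the kernel and the global minimizers. Since `L S = S` and `‖S‖²` is
constant on the manifold, second-order criticality amounts to `‖V‖² ≤ Tr(Vᵀ L V)` for tangent `V`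
(`IsBalanced.trace_le_trace_quadratic_of_tangent`). That inequality is Cauchy–Schwarz between `V -
P_S V` and the tangent projection of `Z Y`, where `Y = Zᵀ V / n`. The norm of the latter is computed
from the sign and shift averages collected in `IsBalanced`. -/

/-! ### Ordered eigenvalues and variational bounds. -/

theorem exists_eigenbasis {m : Type*} [Fintype m] [DecidableEq m] {L : Matrix m m ℝ}
    (hL : L.IsHermitian) :
    ∃ U : Matrix m (Fin (Fintype.card m)) ℝ, Uᵀ * U = 1 ∧ U * Uᵀ = 1 ∧
      L * U = U * Matrix.diagonal hL.eigenvalues₀ := by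
  classical
  set e : Fin (Fintype.card m) ≃ m := Fintype.equivOfCardEq (Fintype.card_fin _) with he
  set V : Matrix m m ℝ := (hL.eigenvectorUnitary : Matrix m m ℝ) with hV
  have h1 : Vᵀ * V = 1 := by
    have := Unitary.coe_star_mul_self hL.eigenvectorUnitary
    simpa [Matrix.star_eq_conjTranspose] using! this
  have h2 : V * Vᵀ = 1 := mul_eq_one_comm.mp h1
  refine ⟨V.submatrix id e, ?_, ?_, ?_⟩
  · have : (V.submatrix id e)ᵀ * V.submatrix id e = (Vᵀ * V).submatrix e e := rfl
    rw [this, h1]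
    exact Matrix.submatrix_one_equiv e
  · rw [Matrix.transpose_submatrix, Matrix.submatrix_mul_equiv, h2, Matrix.submatrix_id_id]
  · ext x i
    have h3 := congrFun (hL.mulVec_eigenvectorBasis (e i)) x
    have h4 : hL.eigenvalues (e i) = hL.eigenvalues₀ i := by
      simp [Matrix.IsHermitian.eigenvalues, he]
    rw [Matrix.mul_diagonal]
    rw [h4] at h3
    simpa [Matrix.mul_apply, Matrix.mulVec, dotProduct, hV, mul_comm] using h3

theorem trace_transpose_mul_self {m q : Type*} [Fintype m] [Fintype q] (X : Matrix m q ℝ) :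
    (Xᵀ * X).trace = ∑ i, ∑ b, X i b ^ 2 := by
  simp only [Matrix.trace, Matrix.diag, Matrix.mul_apply, Matrix.transpose_apply]
  rw [Finset.sum_comm]
  simp [sq]

theorem trace_transpose_mul_self_nonneg {m q : Type*} [Fintype m] [Fintype q]
    (X : Matrix m q ℝ) : 0 ≤ (Xᵀ * X).trace := by
  rw [trace_transpose_mul_self]; positivity

theorem trace_quadratic_diagonal {N q : Type*} [Fintype N] [DecidableEq N] [Fintype q]
    (v : N → ℝ) (C : Matrix N q ℝ) :
    (Cᵀ * (Matrix.diagonal v * C)).trace = ∑ i, v i * ∑ b, C i b ^ 2 := by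
  simp only [Matrix.trace, Matrix.diag, Matrix.mul_apply (M := Cᵀ), Matrix.transpose_apply,
    Matrix.diagonal_mul]
  rw [Finset.sum_comm]
  refine Finset.sum_congr rfl fun i _ => ?_
  rw [Finset.mul_sum]
  exact Finset.sum_congr rfl fun b _ => by ring

section
variable {m : Type*} [Fintype m] [DecidableEq m] {L : Matrix m m ℝ}

theorem kthEigenvalue_eq (hL : L.IsHermitian) {k : ℕ} (h1 : 1 ≤ k) (h2 : k ≤ Fintype.card m) :
    kthEigenvalue L k = hL.eigenvalues₀ ⟨Fintype.card m - k, by omega⟩ := by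
  rw [kthEigenvalue, dif_pos ⟨hL, h1, h2⟩]

/-- Out of range, `kthEigenvalue` takes its default value `0`, so positivity certifies the index. -/
theorem le_card_of_kthEigenvalue_pos {k : ℕ} (h : 0 < kthEigenvalue L k) :
    1 ≤ k ∧ k ≤ Fintype.card m := by
  by_contra hk
  rw [kthEigenvalue, dif_neg fun h' => hk h'.2] at h
  exact lt_irrefl _ h

theorem eigenvalues₀_le_maxEigenvalue (hL : L.IsHermitian) (i : Fin (Fintype.card m)) :
    hL.eigenvalues₀ i ≤ maxEigenvalue L := by
  have hi := i.2
  rw [maxEigenvalue, kthEigenvalue_eq hL (by omega) le_rfl]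
  exact hL.eigenvalues₀_antitone (Fin.le_def.mpr (by simp))

theorem kthEigenvalue_le_eigenvalues₀ (hL : L.IsHermitian) {k : ℕ} (h1 : 1 ≤ k)
    (h2 : k ≤ Fintype.card m) (i : Fin (Fintype.card m)) (hi : (i : ℕ) + k ≤ Fintype.card m) :
    kthEigenvalue L k ≤ hL.eigenvalues₀ i := by
  rw [kthEigenvalue_eq hL h1 h2]
  exact hL.eigenvalues₀_antitone (Fin.le_def.mpr (by simp; omega))

theorem eigenvalues₀_le_kthEigenvalue (hL : L.IsHermitian) {k : ℕ} (h1 : 1 ≤ k)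
    (h2 : k ≤ Fintype.card m) (i : Fin (Fintype.card m)) (hi : Fintype.card m ≤ (i : ℕ) + k) :
    hL.eigenvalues₀ i ≤ kthEigenvalue L k := by
  rw [kthEigenvalue_eq hL h1 h2]
  exact hL.eigenvalues₀_antitone (Fin.le_def.mpr (by simp; omega))

theorem kthEigenvalue_le_maxEigenvalue (hL : L.IsHermitian) {k : ℕ} (h1 : 1 ≤ k)
    (h2 : k ≤ Fintype.card m) : kthEigenvalue L k ≤ maxEigenvalue L := by
  rw [kthEigenvalue_eq hL h1 h2]
  exact eigenvalues₀_le_maxEigenvalue hL _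

theorem exists_eigen_coordinates (hL : L.IsHermitian) :
    ∃ U : Matrix m (Fin (Fintype.card m)) ℝ, Uᵀ * U = 1 ∧ U * Uᵀ = 1 ∧
      L * U = U * Matrix.diagonal hL.eigenvalues₀ ∧
      Uᵀ * L = Matrix.diagonal hL.eigenvalues₀ * Uᵀ ∧
      ∀ {q : Type} [Fintype q] (X : Matrix m q ℝ),
        (Xᵀ * (L * X)).trace = ∑ i, hL.eigenvalues₀ i * ∑ b, (Uᵀ * X) i b ^ 2 ∧
        (Xᵀ * X).trace = ∑ i, ∑ b, (Uᵀ * X) i b ^ 2 := by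
  obtain ⟨U, h1, h2, h3⟩ := exists_eigenbasis hL
  have h4 : Uᵀ * L = Matrix.diagonal hL.eigenvalues₀ * Uᵀ := by
    have := congrArg Matrix.transpose h3
    have hs : Lᵀ = L := by simpa using! hL
    simpa [Matrix.transpose_mul, hs] using this
  refine ⟨U, h1, h2, h3, h4, fun {q} _ X => ⟨?_, ?_⟩⟩
  · rw [← trace_quadratic_diagonal, ← Matrix.mul_assoc (Matrix.diagonal _), ← h4,
      Matrix.transpose_mul, Matrix.transpose_transpose, Matrix.mul_assoc, ← Matrix.mul_assoc U,
      ← Matrix.mul_assoc U, h2, Matrix.one_mul]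
  · rw [← trace_transpose_mul_self, Matrix.transpose_mul, Matrix.transpose_transpose,
      Matrix.mul_assoc, ← Matrix.mul_assoc U, h2, Matrix.one_mul]

theorem trace_quadratic_le_maxEigenvalue (hL : L.IsHermitian) {q : Type} [Fintype q]
    (X : Matrix m q ℝ) :
    (Xᵀ * (L * X)).trace ≤ maxEigenvalue L * (Xᵀ * X).trace := by
  obtain ⟨U, -, -, -, -, h⟩ := exists_eigen_coordinates hL
  rw [(h X).1, (h X).2, Finset.mul_sum]
  gcongr with i
  exact eigenvalues₀_le_maxEigenvalue hL i

/-- If the `d` columns of `Z` are orthogonal, of equal positive length, and killed by `L`, and the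
`d + 1`-st smallest eigenvalue is positive, then the latter bounds `L` below on the orthogonal
complement of `Z`. -/
theorem kthEigenvalue_mul_le_trace_quadratic (hL : L.IsHermitian) {d : ℕ} {ν : ℝ} (hν : ν ≠ 0)
    {Z : Matrix m (Fin d) ℝ} (hZ : Zᵀ * Z = ν • 1) (hLZ : L * Z = 0)
    (hpos : 0 < kthEigenvalue L (d + 1)) {q : Type} [Fintype q] {X : Matrix m q ℝ}
    (hX : Zᵀ * X = 0) :
    kthEigenvalue L (d + 1) * (Xᵀ * X).trace ≤ (Xᵀ * (L * X)).trace := by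
  obtain ⟨U, h1, h2, h3, h4, h⟩ := exists_eigen_coordinates hL
  obtain ⟨hk1, hk2⟩ := le_card_of_kthEigenvalue_pos hpos
  set W := Uᵀ * Z with hW
  set C := Uᵀ * X with hC
  -- In eigencoordinates `L Z = 0` forces `Z` to vanish on every coordinate with nonzero eigenvalue,
  -- hence on all but the `d` smallest.
  have hWz : ∀ i : Fin (Fintype.card m), (i : ℕ) + (d + 1) ≤ Fintype.card m → ∀ j, W i j = 0 := by
    intro i hi j
    have : Matrix.diagonal hL.eigenvalues₀ * W = 0 := by
      rw [hW, ← Matrix.mul_assoc, ← h4, Matrix.mul_assoc, hLZ, Matrix.mul_zero]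
    have h5 := congrFun (congrFun this i) j
    rw [Matrix.diagonal_mul] at h5
    have := kthEigenvalue_le_eigenvalues₀ hL hk1 hk2 i hi
    rcases mul_eq_zero.mp h5 with h6 | h6
    · linarith
    · exact h6
  -- The eigenvalues are listed in decreasing order, so the last `d` indices carry the `d` smallest.
  let e : Fin d → Fin (Fintype.card m) := fun j => ⟨Fintype.card m - d + j, by omega⟩
  have he : Function.Injective e := by
    intro a b hab
    have := congrArg Fin.val hab
    simp only [e] at this
    ext; omega
  have hr : ∀ i : Fin (Fintype.card m), i ∉ Set.range e → (i : ℕ) + (d + 1) ≤ Fintype.card m := by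
    intro i hi
    by_contra hcon
    exact hi ⟨⟨i - (Fintype.card m - d), by omega⟩, by ext; simp [e]; omega⟩
  have hlow : ∀ {q : Type} (Y : Matrix (Fin (Fintype.card m)) q ℝ),
      (W.submatrix e id)ᵀ * Y.submatrix e id = Wᵀ * Y := by
    intro q Y
    ext a b
    simp only [Matrix.mul_apply, Matrix.transpose_apply, Matrix.submatrix_apply, id]
    refine Fintype.sum_of_injective e he _ _ (fun i hi => ?_) fun i => rfl
    rw [hWz i (hr i hi), zero_mul]
  have hWW : Wᵀ * W = ν • 1 := by
    rw [hW, Matrix.transpose_mul, Matrix.transpose_transpose, Matrix.mul_assoc,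
      ← Matrix.mul_assoc U, h2, Matrix.one_mul, hZ]
  have hWC : Wᵀ * C = 0 := by
    rw [hW, hC, Matrix.transpose_mul, Matrix.transpose_transpose, Matrix.mul_assoc,
      ← Matrix.mul_assoc U, h2, Matrix.one_mul, hX]
  rw [← hlow] at hWW hWC
  -- The restricted `W` is square, so its one-sided inverse is two-sided. Orthogonality to `Z`
  -- therefore kills the last `d` coordinates of `X`.
  have hinv : W.submatrix e id * (ν⁻¹ • (W.submatrix e id)ᵀ) = 1 := by
    rw [mul_eq_one_comm, Matrix.smul_mul, hWW, smul_smul, inv_mul_cancel₀ hν, one_smul]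
  have hClow : C.submatrix e id = 0 := by
    calc C.submatrix e id
        = W.submatrix e id * (ν⁻¹ • (W.submatrix e id)ᵀ) * C.submatrix e id := by
          rw [hinv, Matrix.one_mul]
      _ = 0 := by rw [Matrix.mul_assoc, Matrix.smul_mul, hWC, smul_zero, Matrix.mul_zero]
  rw [(h X).1, (h X).2, Finset.mul_sum]
  refine Finset.sum_le_sum fun i _ => ?_
  by_cases hi : i ∈ Set.range e
  · obtain ⟨j, rfl⟩ := hi
    have : ∀ b, C (e j) b = 0 := fun b => congrFun (congrFun hClow j) b
    rw [← hC]; simp [this]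
  · exact mul_le_mul_of_nonneg_right (kthEigenvalue_le_eigenvalues₀ hL hk1 hk2 i (hr i hi))
      (by positivity)

/-- Courant–Fischer: the span of the `d + 1` lowest eigenvectors contains a nonzero vector
satisfying the `d` constraints `Zᵀ X = 0`, and on it the form is at most the eigenvalue. -/
theorem le_kthEigenvalue_of_le_trace_quadratic (hL : L.IsHermitian) {d : ℕ}
    (hd : d + 1 ≤ Fintype.card m) (Z : Matrix m (Fin d) ℝ) (μ : ℝ)
    (hμ : ∀ X : Matrix m Unit ℝ, Zᵀ * X = 0 → μ * (Xᵀ * X).trace ≤ (Xᵀ * (L * X)).trace) :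
    μ ≤ kthEigenvalue L (d + 1) := by
  obtain ⟨U, h1, h2, h3, h4, h⟩ := exists_eigen_coordinates hL
  let e : Fin (d + 1) → Fin (Fintype.card m) := fun j => ⟨Fintype.card m - (d + 1) + j, by omega⟩
  have he : Function.Injective e := by
    intro a b hab
    have := congrArg Fin.val hab
    simp only [e] at this
    ext; omega
  have hker : LinearMap.ker (Matrix.toLin' (Zᵀ * U.submatrix id e)) ≠ ⊥ :=
    LinearMap.ker_ne_bot_of_finrank_lt (by simp)
  obtain ⟨a, ha, ha0⟩ := (Submodule.ne_bot_iff _).mp hker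
  set A : Matrix (Fin (d + 1)) Unit ℝ := Matrix.of fun i _ => a i with hA
  set X := U.submatrix id e * A with hX
  have hZX : Zᵀ * X = 0 := by
    rw [hX, ← Matrix.mul_assoc]
    ext i j
    exact congrFun (LinearMap.mem_ker.mp ha) i
  have hUX : Uᵀ * X = Matrix.of fun i _ => ∑ j, if i = e j then a j else 0 := by
    have : Uᵀ * U.submatrix id e = (1 : Matrix (Fin (Fintype.card m)) (Fin (Fintype.card m)) ℝ).submatrix id e := by
      rw [← h1]; rfl
    rw [hX, ← Matrix.mul_assoc, this]
    ext i j
    simp [Matrix.mul_apply, Matrix.one_apply, hA]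
  have hoff : ∀ i ∉ Set.range e, ∀ b, (Uᵀ * X) i b = 0 := by
    intro i hi b
    rw [hUX]
    show (∑ j, if i = e j then a j else 0) = 0
    exact Finset.sum_eq_zero fun j _ => if_neg fun hij => hi ⟨j, hij.symm⟩
  have hon : ∀ j b, (Uᵀ * X) (e j) b = a j := by
    intro j b
    rw [hUX]
    simp [he.eq_iff]
  have hsq : (Xᵀ * X).trace = ∑ j, a j ^ 2 := by
    rw [(h X).2]
    refine (Fintype.sum_of_injective e he _ _ (fun i hi => ?_) fun i => ?_).symm
    · simp [hoff i hi]
    · simp [hon]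
  have hpos : 0 < ∑ j, a j ^ 2 := by
    obtain ⟨j, hj⟩ := Function.ne_iff.mp ha0
    exact Finset.sum_pos' (fun _ _ => sq_nonneg _) ⟨j, Finset.mem_univ _, by
      have : a j ≠ 0 := hj
      positivity⟩
  have hle : (Xᵀ * (L * X)).trace ≤ kthEigenvalue L (d + 1) * (Xᵀ * X).trace := by
    rw [(h X).1, (h X).2, Finset.mul_sum]
    refine Finset.sum_le_sum fun i _ => ?_
    by_cases hi : i ∈ Set.range e
    · obtain ⟨j, rfl⟩ := hi
      exact mul_le_mul_of_nonneg_right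
        (eigenvalues₀_le_kthEigenvalue hL (by omega) hd _ (by simp only [e]; omega))
        (by positivity)
    · simp [hoff i hi]
  have := (hμ X hZX).trans hle
  rw [hsq] at this
  exact le_of_mul_le_mul_right this hpos

/-- Test the bound on the eigenvector of index `0`, the first in decreasing order. -/
theorem maxEigenvalue_le_of_trace_quadratic_le (hL : L.IsHermitian)
    (hm : 0 < Fintype.card m) (c : ℝ)
    (hc : ∀ X : Matrix m Unit ℝ, (Xᵀ * (L * X)).trace ≤ c * (Xᵀ * X).trace) :
    maxEigenvalue L ≤ c := by
  obtain ⟨U, h1, h2, h3, h4, h⟩ := exists_eigen_coordinates hL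
  rw [maxEigenvalue, kthEigenvalue_eq hL (by omega) le_rfl]
  set i₀ : Fin (Fintype.card m) := ⟨Fintype.card m - Fintype.card m, by omega⟩
  set A : Matrix (Fin (Fintype.card m)) Unit ℝ := Matrix.of fun i _ => if i = i₀ then 1 else 0
  have hUX : Uᵀ * (U * A) = A := by rw [← Matrix.mul_assoc, h1, Matrix.one_mul]
  have := hc (U * A)
  rw [(h _).1, (h _).2, hUX] at this
  simpa [A] using this

end

/-! ### The objective as the quadratic form of the certificate. -/

theorem trace_transpose_mul {m q : Type*} [Fintype m] [Fintype q] (X Y : Matrix m q ℝ) :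
    (Xᵀ * Y).trace = ∑ i, ∑ b, X i b * Y i b := by
  simp only [Matrix.trace, Matrix.diag, Matrix.mul_apply, Matrix.transpose_apply]
  rw [Finset.sum_comm]

theorem trace_bilinear_symm {m q : Type*} [Fintype m] [Fintype q] {L : Matrix m m ℝ}
    (hL : Lᵀ = L) (X Y : Matrix m q ℝ) : (Xᵀ * (L * Y)).trace = (Yᵀ * (L * X)).trace := by
  rw [← Matrix.trace_transpose]
  simp [Matrix.transpose_mul, hL, Matrix.mul_assoc]

/-- A block-diagonal `B` only meets the diagonal blocks of `S Sᵀ`, and these are identities. -/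
theorem trace_blockDiagonal_stiefel {n d q : ℕ}
    {B : Matrix (Fin n × Fin d) (Fin n × Fin d) ℝ} (hB : ∀ x y, x.1 ≠ y.1 → B x y = 0)
    {S : Matrix (Fin n × Fin d) (Fin q) ℝ} (hS : S ∈ Stiefel n d q) :
    (Sᵀ * (B * S)).trace = B.trace := by
  rw [Matrix.trace_mul_comm, Matrix.mul_assoc]
  simp only [Matrix.trace, Matrix.diag]
  refine Finset.sum_congr rfl fun x _ => ?_
  rw [Matrix.mul_apply, Finset.sum_eq_single x]
  · have := congrFun (congrFun (hS x.1) x.2) x.2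
    rw [Matrix.one_apply_eq] at this
    have h2 : (S * Sᵀ) x x = 1 := this
    rw [h2, mul_one]
  · intro y _ hyx
    by_cases h : x.1 = y.1
    · have h3 : x.2 ≠ y.2 := fun h4 => hyx (Prod.ext h.symm h4.symm)
      have h2 : (S * Sᵀ) y x = 0 := by
        obtain ⟨i, a⟩ := x
        obtain ⟨j, b⟩ := y
        obtain rfl : i = j := h
        have := congrFun (congrFun (hS i) b) a
        rw [Matrix.one_apply_ne (Ne.symm h3)] at this
        exact this
      rw [h2, mul_zero]
    · rw [hB x y h, zero_mul]
  · simp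

theorem objective_eq {n d q : ℕ} (A : Matrix (Fin n × Fin d) (Fin n × Fin d) ℝ)
    (Z : Matrix (Fin n × Fin d) (Fin d) ℝ) {S : Matrix (Fin n × Fin d) (Fin q) ℝ}
    (hS : S ∈ Stiefel n d q) :
    objective A S = (Sᵀ * (certificate A Z * S)).trace - (BDG (A * (Z * Zᵀ))).trace := by
  rw [certificate, Matrix.sub_mul, Matrix.mul_sub, Matrix.trace_sub,
    trace_blockDiagonal_stiefel (fun x y hxy => by simp [BDG, hxy]) hS, objective, frob]
  rw [Matrix.transpose_mul, Matrix.transpose_transpose, ← Matrix.mul_assoc,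
    Matrix.trace_mul_comm (A * S)]
  ring

/-! ### Derivatives of quadratic forms along curves. -/

section calculus
variable {m q : Type*} [Fintype m] [Fintype q]

theorem hasDerivAt_trace_bilinear (L : Matrix m m ℝ) {a b : ℝ → Matrix m q ℝ}
    {a' b' : Matrix m q ℝ} {t : ℝ}
    (ha : ∀ x k, HasDerivAt (fun s => a s x k) (a' x k) t)
    (hb : ∀ x k, HasDerivAt (fun s => b s x k) (b' x k) t) :
    HasDerivAt (fun s => ((a s)ᵀ * (L * b s)).trace)
      ((a'ᵀ * (L * b t)).trace + ((a t)ᵀ * (L * b')).trace) t := by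
  simp only [trace_transpose_mul, Matrix.mul_apply, ← Finset.sum_add_distrib]
  refine HasDerivAt.fun_sum fun x _ => HasDerivAt.fun_sum fun k _ => ?_
  exact (ha x k).mul (HasDerivAt.fun_sum fun y _ => (hb y k).const_mul _)

theorem hasDerivAt_trace_quadratic {L : Matrix m m ℝ} (hL : Lᵀ = L) {c : ℝ → Matrix m q ℝ}
    {c' : Matrix m q ℝ} {t : ℝ} (hc : ∀ x k, HasDerivAt (fun s => c s x k) (c' x k) t) :
    HasDerivAt (fun s => ((c s)ᵀ * (L * c s)).trace) (2 * (c'ᵀ * (L * c t)).trace) t := by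
  have := hasDerivAt_trace_bilinear L hc hc
  rwa [trace_bilinear_symm hL (c t), ← two_mul] at this

theorem iteratedDeriv_two_trace_quadratic {L : Matrix m m ℝ} (hL : Lᵀ = L)
    {c c₁ : ℝ → Matrix m q ℝ} {c₂ : Matrix m q ℝ} {t : ℝ}
    (h₁ : ∀ s x k, HasDerivAt (fun s => c s x k) (c₁ s x k) s)
    (h₂ : ∀ x k, HasDerivAt (fun s => c₁ s x k) (c₂ x k) t) :
    iteratedDeriv 2 (fun s => ((c s)ᵀ * (L * c s)).trace) t =
      2 * ((c₂ᵀ * (L * c t)).trace + ((c₁ t)ᵀ * (L * c₁ t)).trace) := by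
  rw [iteratedDeriv_succ, iteratedDeriv_one]
  have : deriv (fun s => ((c s)ᵀ * (L * c s)).trace) =
      fun s => 2 * ((c₁ s)ᵀ * (L * c s)).trace :=
    funext fun s => (hasDerivAt_trace_quadratic hL (h₁ s)).deriv
  rw [this]
  exact ((hasDerivAt_trace_bilinear L h₂ (h₁ t)).const_mul 2).deriv

end calculus

theorem deriv_objective_comp {n d q : ℕ} (A : Matrix (Fin n × Fin d) (Fin n × Fin d) ℝ)
    (Z : Matrix (Fin n × Fin d) (Fin d) ℝ) {c : ℝ → Matrix (Fin n × Fin d) (Fin q) ℝ}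
    (hc : ∀ t, c t ∈ Stiefel n d q) :
    deriv (fun t => objective A (c t)) =
        deriv (fun t => ((c t)ᵀ * (certificate A Z * c t)).trace) ∧
      iteratedDeriv 2 (fun t => objective A (c t)) =
        iteratedDeriv 2 (fun t => ((c t)ᵀ * (certificate A Z * c t)).trace) := by
  have h : deriv (fun t => objective A (c t)) =
      deriv (fun t => ((c t)ᵀ * (certificate A Z * c t)).trace) := by
    funext t
    simp only [fun t => objective_eq A Z (hc t)]
    exact deriv_sub_const _
  refine ⟨h, ?_⟩
  simp only [iteratedDeriv_succ, iteratedDeriv_zero, h]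

/-! ### Exponential curves on the Stiefel manifold. -/

section exponential
open scoped Matrix.Norms.Operator
open NormedSpace

theorem hasDerivAt_mul_exp_smul {d p : ℕ} (S : Matrix (Fin d) (Fin p) ℝ)
    (Ω : Matrix (Fin p) (Fin p) ℝ) (t : ℝ) (a : Fin d) (b : Fin p) :
    HasDerivAt (fun s : ℝ => (S * exp (s • Ω)) a b) ((S * exp (t • Ω) * Ω) a b) t := by
  have h := hasDerivAt_exp_smul_const Ω t
  have h2 : ∀ i j, HasDerivAt (fun s : ℝ => exp (s • Ω) i j) ((exp (t • Ω) * Ω) i j) t :=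
    fun i j => hasDerivAt_pi.mp (hasDerivAt_pi.mp h i) j
  rw [Matrix.mul_assoc]
  simp only [Matrix.mul_apply (M := S)]
  exact HasDerivAt.fun_sum fun k _ => (h2 k b).const_mul _

/-- The derivative has the same form with `S * Ω` in place of `S`, so the induction must be over all
`S`. -/
theorem contDiff_mul_exp_smul {d p : ℕ} (S : Matrix (Fin d) (Fin p) ℝ)
    (Ω : Matrix (Fin p) (Fin p) ℝ) (a : Fin d) (b : Fin p) :
    ContDiff ℝ ∞ (fun s : ℝ => (S * exp (s • Ω)) a b) := by
  rw [contDiff_infty]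
  intro n
  induction n generalizing S with
  | zero =>
    exact contDiff_zero.mpr (continuous_iff_continuousAt.mpr fun t =>
      (hasDerivAt_mul_exp_smul S Ω t a b).continuousAt)
  | succ n ih =>
    push_cast
    rw [contDiff_succ_iff_deriv]
    refine ⟨fun t => (hasDerivAt_mul_exp_smul S Ω t a b).differentiableAt, by simp, ?_⟩
    have hcomm : ∀ t : ℝ, exp (t • Ω) * Ω = Ω * exp (t • Ω) := fun t =>
      (((Commute.refl Ω).smul_left t).exp_left).eq
    have : deriv (fun s : ℝ => (S * exp (s • Ω)) a b) =
        fun s : ℝ => (S * Ω * exp (s • Ω)) a b := funext fun t => by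
      rw [(hasDerivAt_mul_exp_smul S Ω t a b).deriv, Matrix.mul_assoc, hcomm, ← Matrix.mul_assoc]
    rw [this]
    exact ih _

theorem exp_smul_mul_transpose {p : ℕ} {Ω : Matrix (Fin p) (Fin p) ℝ} (hΩ : Ωᵀ = -Ω) (t : ℝ) :
    exp (t • Ω) * (exp (t • Ω))ᵀ = 1 := by
  rw [← Matrix.exp_transpose, Matrix.transpose_smul, hΩ, smul_neg,
    ← Matrix.exp_add_of_commute (t • Ω) (-(t • Ω)) (Commute.refl (t • Ω)).neg_right,
    add_neg_cancel, exp_zero]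

/-- The second variation along the curves `t ↦ S_i exp(t Ω_i)`. -/
theorem IsSecondOrderCritical.second_variation_nonneg {n d p : ℕ}
    {A : Matrix (Fin n × Fin d) (Fin n × Fin d) ℝ} {Z : Matrix (Fin n × Fin d) (Fin d) ℝ}
    {S : Matrix (Fin n × Fin d) (Fin p) ℝ} (hL : (certificate A Z)ᵀ = certificate A Z)
    (hS : IsSecondOrderCritical A S) (Ω : Fin n → Matrix (Fin p) (Fin p) ℝ)
    (hΩ : ∀ i, (Ω i)ᵀ = -Ω i) (V W : Matrix (Fin n × Fin d) (Fin p) ℝ)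
    (hV : ∀ i, block V i = block S i * Ω i) (hW : ∀ i, block W i = block S i * Ω i * Ω i) :
    0 ≤ (Wᵀ * (certificate A Z * S)).trace + (Vᵀ * (certificate A Z * V)).trace := by
  let c : ℝ → Matrix (Fin n × Fin d) (Fin p) ℝ := fun t =>
    Matrix.of fun x b => (block S x.1 * exp (t • Ω x.1)) x.2 b
  let c₁ : ℝ → Matrix (Fin n × Fin d) (Fin p) ℝ := fun t =>
    Matrix.of fun x b => (block S x.1 * exp (t • Ω x.1) * Ω x.1) x.2 b
  have hcS : ∀ t, c t ∈ Stiefel n d p := by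
    intro t i
    have : block (c t) i = block S i * exp (t • Ω i) := rfl
    rw [this, Matrix.transpose_mul, Matrix.mul_assoc, ← Matrix.mul_assoc (exp _),
      exp_smul_mul_transpose (hΩ i), Matrix.one_mul, hS.1 i]
  have hc0 : c 0 = S := by
    ext x b
    simp [c, block]
  have h₁ : ∀ s x k, HasDerivAt (fun s => c s x k) (c₁ s x k) s := fun s x k =>
    hasDerivAt_mul_exp_smul _ _ _ _ _
  have hc₁0 : c₁ 0 = V := by
    ext x b
    have := congrFun (congrFun (hV x.1) x.2) b
    simp only [c₁, zero_smul, exp_zero, Matrix.mul_one, Matrix.of_apply, ← this]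
    rfl
  have h₂ : ∀ x k, HasDerivAt (fun s => c₁ s x k) (W x k) 0 := by
    intro x k
    have hcomm : ∀ t : ℝ, exp (t • Ω x.1) * Ω x.1 = Ω x.1 * exp (t • Ω x.1) := fun t =>
      (((Commute.refl (Ω x.1)).smul_left t).exp_left).eq
    have h := hasDerivAt_mul_exp_smul (block S x.1 * Ω x.1) (Ω x.1) 0 x.2 k
    have hw := congrFun (congrFun (hW x.1) x.2) k
    simp only [zero_smul, exp_zero, Matrix.mul_one, ← hw] at h
    refine h.congr_of_eventuallyEq (Filter.Eventually.of_forall fun s => ?_)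
    simp only [c₁, Matrix.of_apply]
    rw [Matrix.mul_assoc, hcomm, ← Matrix.mul_assoc]
  have h := (hS.2 c (fun x b => contDiff_mul_exp_smul _ _ _ _) hcS hc0).2
  rw [(deriv_objective_comp A Z hcS).2, iteratedDeriv_two_trace_quadratic hL h₁ h₂, hc0,
    hc₁0] at h
  linarith

end exponential

/-! ### Averages over matrix units. -/

section units
variable {d p : ℕ}

/-- The matrix units `E_{ab}`, indexed by pairs. -/
def unit (x : Fin d × Fin p) : Matrix (Fin d) (Fin p) ℝ := Matrix.single x.1 x.2 1

theorem unit_apply (x : Fin d × Fin p) (i : Fin d) (j : Fin p) :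
    unit x i j = if x.1 = i ∧ x.2 = j then 1 else 0 := by
  simp [unit, Matrix.single_apply]

theorem mul_unit_apply {m : Type*} (M : Matrix m (Fin d) ℝ) (x : Fin d × Fin p) (i : m)
    (j : Fin p) : (M * unit x) i j = if x.2 = j then M i x.1 else 0 := by
  simp [Matrix.mul_apply, unit_apply, ite_and]

theorem mul_unit_transpose_apply {m : Type*} (M : Matrix m (Fin p) ℝ) (x : Fin d × Fin p) (i : m)
    (j : Fin d) : (M * (unit x)ᵀ) i j = if x.1 = j then M i x.2 else 0 := by
  by_cases h : x.1 = j <;> simp [Matrix.mul_apply, unit_apply, h]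

theorem unit_mul_apply {m : Type*} (M : Matrix (Fin p) m ℝ) (x : Fin d × Fin p) (i : Fin d)
    (j : m) : (unit x * M) i j = if x.1 = i then M x.2 j else 0 := by
  simp [Matrix.mul_apply, unit_apply, ite_and]

theorem unit_transpose_mul_apply {m : Type*} (M : Matrix (Fin d) m ℝ) (x : Fin d × Fin p)
    (i : Fin p) (j : m) : ((unit x)ᵀ * M) i j = if x.2 = i then M x.1 j else 0 := by
  simp [Matrix.mul_apply, unit_apply, ite_and]

/-- This and its three variants evaluate every expression quadratic in the test direction: two equal
factors produce a transpose, a factor and its transpose produce a trace. -/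
theorem sum_unit_mul_unit (M : Matrix (Fin p) (Fin d) ℝ) :
    ∑ x : Fin d × Fin p, unit x * M * unit x = Mᵀ := by
  ext i j
  simp [Matrix.sum_apply, mul_unit_apply, unit_mul_apply, Fintype.sum_prod_type]

theorem sum_unit_transpose_mul_unit_transpose (M : Matrix (Fin d) (Fin p) ℝ) :
    ∑ x : Fin d × Fin p, (unit x)ᵀ * M * (unit x)ᵀ = Mᵀ := by
  ext i j
  simp [Matrix.sum_apply, mul_unit_transpose_apply, unit_transpose_mul_apply,
    Fintype.sum_prod_type]

theorem sum_unit_mul_unit_transpose (M : Matrix (Fin p) (Fin p) ℝ) :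
    ∑ x : Fin d × Fin p, unit x * M * (unit x)ᵀ = M.trace • 1 := by
  ext i j
  by_cases h : i = j
  · subst h
    simp [Matrix.sum_apply, mul_unit_transpose_apply, unit_mul_apply, Fintype.sum_prod_type,
      Matrix.trace]
  · simp [Matrix.sum_apply, mul_unit_transpose_apply, unit_mul_apply, Fintype.sum_prod_type,
      Matrix.trace, h, Ne.symm h]

theorem sum_unit_transpose_mul_unit (M : Matrix (Fin d) (Fin d) ℝ) :
    ∑ x : Fin d × Fin p, (unit x)ᵀ * M * unit x = M.trace • 1 := by
  ext i j
  by_cases h : i = j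
  · subst h
    simp [Matrix.sum_apply, mul_unit_apply, unit_transpose_mul_apply, Fintype.sum_prod_type,
      Matrix.trace]
  · simp [Matrix.sum_apply, mul_unit_apply, unit_transpose_mul_apply, Fintype.sum_prod_type,
      Matrix.trace, h, Ne.symm h]

theorem sum_unit_mul_transpose :
    ∑ x : Fin d × Fin p, unit x * (unit x)ᵀ = (p : ℝ) • 1 := by
  simpa using sum_unit_mul_unit_transpose (d := d) (1 : Matrix (Fin p) (Fin p) ℝ)

theorem sum_unit_transpose_mul :
    ∑ x : Fin d × Fin p, (unit x)ᵀ * unit x = (d : ℝ) • 1 := by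
  simpa using sum_unit_transpose_mul_unit (p := p) (1 : Matrix (Fin d) (Fin d) ℝ)

end units

/-! ### Tangent projections and their averages at one Stiefel block. -/

section tangent
variable {d p : ℕ} {T : Matrix (Fin d) (Fin p) ℝ}

/-- The symmetric part of `X Tᵀ`. -/
noncomputable def symPart (T X : Matrix (Fin d) (Fin p) ℝ) : Matrix (Fin d) (Fin d) ℝ :=
  (2⁻¹ : ℝ) • (X * Tᵀ + T * Xᵀ)

/-- A skew-symmetric matrix `Ω` such that `T Ω` is the projection of `X` onto the tangent space
of the Stiefel manifold at `T`. -/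
noncomputable def rotation (T X : Matrix (Fin d) (Fin p) ℝ) : Matrix (Fin p) (Fin p) ℝ :=
  Tᵀ * X - Xᵀ * T + (2⁻¹ : ℝ) • (Tᵀ * (T * Xᵀ - X * Tᵀ) * T)

theorem symPart_transpose (T X : Matrix (Fin d) (Fin p) ℝ) : (symPart T X)ᵀ = symPart T X := by
  simp [symPart, add_comm]

theorem rotation_transpose (T X : Matrix (Fin d) (Fin p) ℝ) :
    (rotation T X)ᵀ = -rotation T X := by
  simp only [rotation, Matrix.transpose_add, Matrix.transpose_sub, Matrix.transpose_mul,
    Matrix.transpose_smul, Matrix.transpose_transpose, Matrix.mul_sub, Matrix.sub_mul,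
    Matrix.mul_assoc]
  module

theorem mul_transpose_mul_cancel (hT : T * Tᵀ = 1) {q : Type*} (M : Matrix (Fin d) q ℝ) :
    T * (Tᵀ * M) = M := by
  rw [← Matrix.mul_assoc, hT, Matrix.one_mul]

theorem mul_rotation (hT : T * Tᵀ = 1) (X : Matrix (Fin d) (Fin p) ℝ) :
    T * rotation T X = X - symPart T X * T := by
  simp only [rotation, symPart, Matrix.mul_add, Matrix.add_mul, Matrix.mul_sub, Matrix.sub_mul,
    Matrix.mul_assoc, Matrix.mul_smul, Matrix.smul_mul, mul_transpose_mul_cancel hT]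
  module

theorem mul_rotation_mul_rotation (hT : T * Tᵀ = 1) (X : Matrix (Fin d) (Fin p) ℝ) :
    T * rotation T X * rotation T X =
      (2⁻¹ : ℝ) • (X * Tᵀ * X) - (2⁻¹ : ℝ) • (T * (Xᵀ * X)) - X * Xᵀ * T +
        ((3 / 4 : ℝ) • (X * (Tᵀ * T) * Xᵀ) - (1 / 4 : ℝ) • (X * Tᵀ * X * Tᵀ) +
          (1 / 4 : ℝ) • (T * (Xᵀ * T * Xᵀ)) + (1 / 4 : ℝ) • (T * (Xᵀ * X) * Tᵀ)) * T := by
  rw [mul_rotation hT]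
  simp only [rotation, symPart, Matrix.mul_add, Matrix.add_mul, Matrix.mul_sub, Matrix.sub_mul,
    Matrix.mul_assoc, Matrix.mul_smul, Matrix.smul_mul, mul_transpose_mul_cancel hT,
    smul_add, smul_sub]
  module

theorem trace_transpose_mul_self_of_stiefel (hT : T * Tᵀ = 1) : (Tᵀ * T).trace = d := by
  rw [Matrix.trace_mul_comm, hT, Matrix.trace_one, Fintype.card_fin]

/-- The averaged acceleration is a multiple of `T` itself, which turns the second variation into a
bound on the form of `L` at `S`. -/
theorem sum_mul_rotation_mul_rotation (hT : T * Tᵀ = 1) :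
    ∑ x, T * rotation T (unit x) * rotation T (unit x) = -((p : ℝ) - (d + 1) / 2) • T := by
  simp only [mul_rotation_mul_rotation hT, Finset.sum_add_distrib, Finset.sum_sub_distrib,
    ← Finset.smul_sum, ← Matrix.sum_mul, ← Matrix.mul_sum, sum_unit_mul_unit,
    sum_unit_transpose_mul_unit_transpose, sum_unit_mul_unit_transpose,
    sum_unit_mul_transpose, sum_unit_transpose_mul, trace_transpose_mul_self_of_stiefel hT,
    Matrix.transpose_transpose, hT, Matrix.mul_smul, Matrix.smul_mul, Matrix.mul_one,
    Matrix.one_mul, Matrix.add_mul, Matrix.sub_mul]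
  module

/-- The parameter `τ` serves two purposes: `τ = (d+1)/(2p)` in the averaged inequality, and `τ = 1`,
minus the tangent projection of `X`, for the twisted state. -/
theorem symPart_residual_mul_transpose (hT : T * Tᵀ = 1) (X : Matrix (Fin d) (Fin p) ℝ) (τ : ℝ) :
    (symPart T X * T - τ • X) * (symPart T X * T - τ • X)ᵀ =
      (1 / 4 - τ / 2 : ℝ) • (X * Tᵀ * X * Tᵀ + T * (Xᵀ * T * Xᵀ)) +
      (1 / 4 - τ : ℝ) • (X * (Tᵀ * T) * Xᵀ) + (1 / 4 : ℝ) • (T * (Xᵀ * X) * Tᵀ) +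
      τ ^ 2 • (X * Xᵀ) := by
  rw [Matrix.transpose_sub, Matrix.transpose_mul, symPart_transpose]
  simp only [symPart, Matrix.mul_add, Matrix.add_mul, Matrix.mul_sub, Matrix.sub_mul,
    Matrix.mul_assoc, Matrix.mul_smul, Matrix.smul_mul, mul_transpose_mul_cancel hT,
    smul_add, smul_sub, Matrix.transpose_smul]
  module

theorem sum_symPart_residual (hT : T * Tᵀ = 1) (τ : ℝ) :
    ∑ x, (symPart T (unit x) * T - τ • unit x) * (symPart T (unit x) * T - τ • unit x)ᵀ =
      (((d : ℝ) + 1) / 2 * (1 - 2 * τ) + τ ^ 2 * p) • 1 := by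
  simp only [symPart_residual_mul_transpose hT, Finset.sum_add_distrib,
    ← Finset.smul_sum, ← Matrix.sum_mul, ← Matrix.mul_sum, sum_unit_mul_unit,
    sum_unit_transpose_mul_unit_transpose, sum_unit_mul_unit_transpose,
    sum_unit_mul_transpose, sum_unit_transpose_mul, trace_transpose_mul_self_of_stiefel hT,
    Matrix.transpose_transpose, hT, Matrix.mul_smul, Matrix.smul_mul, Matrix.mul_one]
  module

end tangent

/-! ### The averaged second-order inequality and the condition-number bound. -/

section stacked
variable {n d p : ℕ}

/-- The stacked matrix with prescribed blocks. -/
def stack {q : ℕ} (B : Fin n → Matrix (Fin d) (Fin q) ℝ) : Matrix (Fin n × Fin d) (Fin q) ℝ :=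
  Matrix.of fun x b => B x.1 x.2 b

@[simp] theorem block_stack {q : ℕ} (B : Fin n → Matrix (Fin d) (Fin q) ℝ) (i : Fin n) :
    block (stack B) i = B i := rfl

theorem stack_block {q : ℕ} (S : Matrix (Fin n × Fin d) (Fin q) ℝ) : stack (block S) = S := rfl

theorem block_mul {q r : ℕ} (S : Matrix (Fin n × Fin d) (Fin q) ℝ) (X : Matrix (Fin q) (Fin r) ℝ)
    (i : Fin n) : block (S * X) i = block S i * X := rfl

theorem transpose_mul_eq_sum_block {q r : ℕ} (S : Matrix (Fin n × Fin d) (Fin q) ℝ)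
    (R : Matrix (Fin n × Fin d) (Fin r) ℝ) : Sᵀ * R = ∑ i, (block S i)ᵀ * block R i := by
  ext a b
  simp [Matrix.mul_apply, Matrix.sum_apply, Fintype.sum_prod_type, block]

theorem transpose_mul_block_of_orthogonal {Z : Matrix (Fin n × Fin d) (Fin d) ℝ}
    (hZ : Z ∈ Stiefel n d d) (i : Fin n) : (block Z i)ᵀ * block Z i = 1 :=
  mul_eq_one_comm.mp (hZ i)

theorem transpose_mul_self_of_orthogonal {Z : Matrix (Fin n × Fin d) (Fin d) ℝ}
    (hZ : Z ∈ Stiefel n d d) : Zᵀ * Z = (n : ℝ) • 1 := by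
  simp [transpose_mul_eq_sum_block, transpose_mul_block_of_orthogonal hZ, ← Nat.cast_smul_eq_nsmul ℝ]

theorem trace_transpose_mul_self_of_mem_stiefel {S : Matrix (Fin n × Fin d) (Fin p) ℝ}
    (hS : S ∈ Stiefel n d p) : (Sᵀ * S).trace = n * d := by
  simp [transpose_mul_eq_sum_block, Matrix.trace_sum, trace_transpose_mul_self_of_stiefel (hS _)]

theorem second_order_inequality (hp : 0 < p) {A : Matrix (Fin n × Fin d) (Fin n × Fin d) ℝ}
    {Z : Matrix (Fin n × Fin d) (Fin d) ℝ} (hZ : Z ∈ Stiefel n d d)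
    (hL : (certificate A Z).IsHermitian) (hLZ : certificate A Z * Z = 0)
    {S : Matrix (Fin n × Fin d) (Fin p) ℝ} (hS : IsSecondOrderCritical A S) :
    ((p : ℝ) - (d + 1) / 2) * (Sᵀ * (certificate A Z * S)).trace ≤
      maxEigenvalue (certificate A Z) *
        (n * d * (((d : ℝ) + 1) / 2 * (1 - (d + 1) / (2 * p)))) := by
  set L := certificate A Z with hLdef
  have hLt : Lᵀ = L := by simpa using! hL
  -- This value minimizes `(d+1)/2 * (1 - 2τ) + τ² p`, the factor in `sum_symPart_residual`.
  set τ : ℝ := (d + 1) / (2 * p) with hτ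
  let T : Fin n → Matrix (Fin d) (Fin p) ℝ := fun i => (block Z i)ᵀ * block S i
  have hT : ∀ i, T i * (T i)ᵀ = 1 := fun i => by
    simp only [T, Matrix.transpose_mul, Matrix.transpose_transpose]
    rw [Matrix.mul_assoc, ← Matrix.mul_assoc (block S i), hS.1 i, Matrix.one_mul,
      transpose_mul_block_of_orthogonal hZ]
  have hST : ∀ i, block S i = block Z i * T i := fun i => by
    rw [← Matrix.mul_assoc, hZ i, Matrix.one_mul]
  let Ω : Fin d × Fin p → Fin n → Matrix (Fin p) (Fin p) ℝ := fun x i => rotation (T i) (unit x)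
  let V : Fin d × Fin p → Matrix (Fin n × Fin d) (Fin p) ℝ := fun x =>
    stack fun i => block S i * Ω x i
  let W : Fin d × Fin p → Matrix (Fin n × Fin d) (Fin p) ℝ := fun x =>
    stack fun i => block S i * Ω x i * Ω x i
  let R : Fin d × Fin p → Matrix (Fin n × Fin d) (Fin p) ℝ := fun x =>
    stack fun i => block Z i * (symPart (T i) (unit x) * T i - τ • unit x)
  have hVR : ∀ x, V x = (1 - τ) • (Z * unit x) - R x := by
    intro x
    rw [← stack_block (Z * unit x)]
    have : ∀ i, block S i * Ω x i = (1 - τ) • (block Z i * unit x) -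
        block Z i * (symPart (T i) (unit x) * T i - τ • unit x) := by
      intro i
      rw [hST, Matrix.mul_assoc, mul_rotation (hT i)]
      simp only [Matrix.mul_sub, Matrix.mul_smul]
      module
    ext y b
    exact congrFun (congrFun (this y.1) y.2) b
  -- `V` and `-R` differ by a multiple of `Z * unit x`, which `L` annihilates.
  have hLV : ∀ x, ((V x)ᵀ * (L * V x)).trace = ((R x)ᵀ * (L * R x)).trace := by
    intro x
    have h1 : L * V x = -(L * R x) := by
      rw [hVR, Matrix.mul_sub, Matrix.mul_smul, ← Matrix.mul_assoc, hLZ, Matrix.zero_mul,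
        smul_zero, zero_sub]
    rw [h1, Matrix.mul_neg, Matrix.trace_neg, trace_bilinear_symm hLt, h1, Matrix.mul_neg,
      Matrix.trace_neg, neg_neg]
  have hW : ∑ x, W x = -((p : ℝ) - (d + 1) / 2) • S := by
    have : ∀ i, ∑ x, block S i * Ω x i * Ω x i = -((p : ℝ) - (d + 1) / 2) • block S i := by
      intro i
      rw [hST, ← Matrix.mul_smul, ← sum_mul_rotation_mul_rotation (hT i), Matrix.mul_sum]
      exact Finset.sum_congr rfl fun x _ => by simp only [Ω, Matrix.mul_assoc]
    ext y b
    have h := congrFun (congrFun (this y.1) y.2) b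
    rw [Matrix.sum_apply] at h ⊢
    exact h
  have hR : ∑ x, ((R x)ᵀ * R x).trace = n * d * (((d : ℝ) + 1) / 2 * (1 - τ)) := by
    have h1 : ∀ x, ((R x)ᵀ * R x).trace =
        ∑ i, ((symPart (T i) (unit x) * T i - τ • unit x) *
          (symPart (T i) (unit x) * T i - τ • unit x)ᵀ).trace := by
      intro x
      rw [transpose_mul_eq_sum_block, Matrix.trace_sum]
      refine Finset.sum_congr rfl fun i _ => ?_
      rw [block_stack, Matrix.transpose_mul, Matrix.mul_assoc, ← Matrix.mul_assoc (block Z i)ᵀ,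
        transpose_mul_block_of_orthogonal hZ, Matrix.one_mul, Matrix.trace_mul_comm]
    simp only [h1]
    rw [Finset.sum_comm]
    simp only [← Matrix.trace_sum, sum_symPart_residual (hT _), Matrix.trace_smul,
      Matrix.trace_one, Fintype.card_fin, Finset.sum_const, Finset.card_univ, smul_eq_mul,
      nsmul_eq_mul]
    have hp' : (p : ℝ) ≠ 0 := by positivity
    rw [hτ]
    field_simp
    ring
  have hmain : ∀ x, 0 ≤ ((W x)ᵀ * (L * S)).trace + maxEigenvalue L * ((R x)ᵀ * R x).trace := by
    intro x
    refine (hS.second_variation_nonneg hLt (Ω x) (fun i => rotation_transpose _ _) (V x) (W x)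
      (fun i => rfl) (fun i => rfl)).trans ?_
    rw [← hLdef, hLV]
    gcongr
    exact trace_quadratic_le_maxEigenvalue hL _
  have hsum := Finset.sum_nonneg fun x (_ : x ∈ Finset.univ) => hmain x
  rw [Finset.sum_add_distrib, ← Finset.mul_sum, hR, ← Matrix.trace_sum, ← Matrix.sum_mul,
    ← Matrix.transpose_sum, hW, Matrix.transpose_smul, Matrix.smul_mul, Matrix.trace_smul,
    smul_eq_mul] at hsum
  linarith

theorem not_isSecondOrderCritical_of_condition_number (hd : 1 ≤ d) (hp : d ≤ p)
    {A : Matrix (Fin n × Fin d) (Fin n × Fin d) ℝ} {Z : Matrix (Fin n × Fin d) (Fin d) ℝ}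
    (hZ : Z ∈ Stiefel n d d) (hL : (certificate A Z).PosSemidef) (hLZ : certificate A Z * Z = 0)
    (hpos : 0 < kthEigenvalue (certificate A Z) (d + 1))
    (hratio : maxEigenvalue (certificate A Z) / kthEigenvalue (certificate A Z) (d + 1) <
      2 * (p : ℝ) / ((d : ℝ) + 1))
    {S : Matrix (Fin n × Fin d) (Fin p) ℝ} (hZS : Zᵀ * S = 0) :
    ¬ IsSecondOrderCritical A S := by
  intro hS
  have hH := hL.isHermitian
  obtain ⟨hk1, hk2⟩ := le_card_of_kthEigenvalue_pos hpos
  have hn : 0 < n := by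
    rcases Nat.eq_zero_or_pos n with rfl | h
    · simp at hk2
    · exact h
  have hn' : (0 : ℝ) < n := by exact_mod_cast hn
  have hd' : (1 : ℝ) ≤ d := by exact_mod_cast hd
  have hp' : (d : ℝ) ≤ p := by exact_mod_cast hp
  have hp0 : (0 : ℝ) < p := by linarith
  have h1 := second_order_inequality (by omega) hZ hH hLZ hS
  have h2 := kthEigenvalue_mul_le_trace_quadratic hH hn'.ne'
    (transpose_mul_self_of_orthogonal hZ) hLZ hpos hZS
  have h3 := kthEigenvalue_le_maxEigenvalue hH hk1 hk2
  rw [trace_transpose_mul_self_of_mem_stiefel hS.1] at h2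
  set lam := kthEigenvalue (certificate A Z) (d + 1)
  set Λ := maxEigenvalue (certificate A Z)
  rw [div_lt_div_iff₀ hpos (by positivity)] at hratio
  -- The ratio is at least `1`, so its upper bound forces `d + 1 < 2p`; this excludes `d = p = 1`,
  -- where the averaged inequality is empty.
  have hgap : 0 < (p : ℝ) - (d + 1) / 2 := by
    have : lam * (d + 1) < 2 * p * lam := by nlinarith
    nlinarith
  have h4 : Λ * (n * d * (((d : ℝ) + 1) / 2 * (1 - (d + 1) / (2 * p)))) =
      ((p : ℝ) - (d + 1) / 2) * (Λ * (d + 1) * (n * d) / (2 * p)) := by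
    have : (p : ℝ) ≠ 0 := by positivity
    field_simp
  rw [h4] at h1
  have h5 := h2.trans (le_of_mul_le_mul_left h1 hgap)
  rw [le_div_iff₀ (by positivity)] at h5
  have : Λ * (d + 1) * (n * d) < 2 * p * lam * (n * d) := by gcongr
  linarith

end stacked

/-! ### Sign and shift averages of the twisted blocks. -/

section twisted
variable {d p : ℕ}

theorem neg_one_pow_rev (x : Fin 2) : (-1 : ℝ) ^ (x.rev : ℕ) = -(-1) ^ (x : ℕ) := by
  fin_cases x <;> simp [Fin.rev]

theorem sum_sign_mul_sign (a b : Fin d) :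
    ∑ σ : Fin d → Fin 2, (-1 : ℝ) ^ (σ a : ℕ) * (-1) ^ (σ b : ℕ) =
      if a = b then 2 ^ d else 0 := by
  split_ifs with h
  · subst h
    simp [← pow_add, ← two_mul]
  -- Flipping the sign at `a` alone negates each summand when `a ≠ b`.
  · let e : Equiv.Perm (Fin d → Fin 2) :=
      Function.Involutive.toPerm (fun σ => Function.update σ a (σ a).rev) fun σ => by simp
    have he : ∀ σ, e σ = Function.update σ a (σ a).rev := fun σ => rfl
    have hsum := Equiv.sum_comp e
      (fun σ : Fin d → Fin 2 => (-1 : ℝ) ^ (σ a : ℕ) * (-1) ^ (σ b : ℕ))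
    have : ∀ σ : Fin d → Fin 2, (-1 : ℝ) ^ (e σ a : ℕ) * (-1) ^ (e σ b : ℕ) =
        -((-1 : ℝ) ^ (σ a : ℕ) * (-1) ^ (σ b : ℕ)) := by
      intro σ
      simp only [he, Function.update_self,
        Function.update_of_ne (Ne.symm h), neg_one_pow_rev]
      ring
    simp only [this, Finset.sum_neg_distrib] at hsum
    linarith

/-- The block `diag((-1)^σ) [I_d, 0] M^(k+1)`. -/
def signedShift (p : ℕ) (σ : Fin d → Fin 2) (k : Fin p) : Matrix (Fin d) (Fin p) ℝ :=
  Matrix.diagonal (fun a => (-1 : ℝ) ^ (σ a : ℕ)) * frame d p * cyclic p ^ ((k : ℕ) + 1)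

theorem sum_twistedBlock {M : Type*} [AddCommMonoid M] (F : Matrix (Fin d) (Fin p) ℝ → M) :
    ∑ i, F (twistedBlock d p i) = ∑ σ : Fin d → Fin 2, ∑ k : Fin p, F (signedShift p σ k) := by
  rw [← Fintype.sum_prod_type' (f := fun σ k => F (signedShift p σ k)),
    ← Equiv.sum_comp (finProdFinEquiv.symm.trans
      (Equiv.prodCongr finFunctionFinEquiv.symm (Equiv.refl (Fin p))))]
  rfl

/-- The column of the nonzero entry in row `a` of the `k`-th shifted frame. -/
def shiftColumn (hp : d ≤ p) (a : Fin d) (k : Fin p) : Fin p :=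
  ⟨((a : ℕ) + (k + 1)) % p, Nat.mod_lt _ (by have := a.2; omega)⟩

theorem shiftColumn_injective_left (hp : d ≤ p) (k : Fin p) :
    Function.Injective fun a => shiftColumn hp a k := by
  intro a b h
  have h1 : ((a : ℕ) + (k + 1)) % p = ((b : ℕ) + (k + 1)) % p := congrArg Fin.val h
  have h2 : (a : ℕ) ≡ b [MOD p] := Nat.ModEq.add_right_cancel' _ h1
  have ha := a.2
  have hb := b.2
  exact Fin.ext (h2.eq_of_lt_of_lt (by omega) (by omega))

theorem shiftColumn_bijective_right (hp : d ≤ p) (a : Fin d) :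
    Function.Bijective fun k => shiftColumn hp a k := by
  refine Finite.injective_iff_bijective.mp fun k l h => ?_
  have h1 : ((a : ℕ) + (k + 1)) % p = ((a : ℕ) + (l + 1)) % p := congrArg Fin.val h
  have h2 : (k : ℕ) + 1 ≡ l + 1 [MOD p] := Nat.ModEq.add_left_cancel' _ h1
  exact Fin.ext ((Nat.ModEq.add_right_cancel' 1 h2).eq_of_lt_of_lt k.2 l.2)

theorem cyclic_apply (p : ℕ) (a b : Fin p) :
    cyclic p a b = if (b : ℕ) = ((a : ℕ) + 1) % p then 1 else 0 := rfl

theorem cyclic_pow_apply (p m : ℕ) (a b : Fin p) :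
    (cyclic p ^ m) a b = if (b : ℕ) = ((a : ℕ) + m) % p then 1 else 0 := by
  induction m generalizing b with
  | zero =>
    simp [Matrix.one_apply, Nat.mod_eq_of_lt a.2, Fin.ext_iff, eq_comm]
  | succ m ih =>
    rw [pow_succ, Matrix.mul_apply,
      Finset.sum_eq_single (⟨((a : ℕ) + m) % p, Nat.mod_lt _ (by have := a.2; omega)⟩ : Fin p)]
    · simp [ih, cyclic_apply, add_assoc]
    · intro c _ hc
      rw [ih, if_neg fun h => hc (Fin.ext h), zero_mul]
    · simp

theorem signedShift_apply (hp : d ≤ p) (σ : Fin d → Fin 2) (k : Fin p) (a : Fin d) (b : Fin p) :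
    signedShift p σ k a b = if b = shiftColumn hp a k then (-1) ^ (σ a : ℕ) else 0 := by
  rw [signedShift, Matrix.mul_assoc, Matrix.diagonal_mul, Matrix.mul_apply,
    Finset.sum_eq_single (Fin.castLE hp a)]
  · simp [frame, cyclic_pow_apply, shiftColumn, Fin.ext_iff]
  · intro c _ hc
    have : (a : ℕ) ≠ c := fun h => hc (Fin.ext h.symm)
    simp [frame, this]
  · simp

theorem signedShift_mul_transpose (hp : d ≤ p) (σ : Fin d → Fin 2) (k : Fin p) :
    signedShift p σ k * (signedShift p σ k)ᵀ = 1 := by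
  ext a b
  simp only [Matrix.mul_apply, Matrix.transpose_apply, signedShift_apply hp, ite_mul, zero_mul,
    Finset.sum_ite_eq', Finset.mem_univ, if_true]
  by_cases h : a = b
  · subst h
    simp [← pow_add, ← two_mul]
  · have : shiftColumn hp a k ≠ shiftColumn hp b k :=
      fun h' => h (shiftColumn_injective_left hp k h')
    simp [this, h]

theorem twistedBlock_mul_transpose (hp : d ≤ p) (i : Fin (2 ^ d * p)) :
    twistedBlock d p i * (twistedBlock d p i)ᵀ = 1 :=
  signedShift_mul_transpose hp _ _

/-- Flipping all signs permutes the blocks and sends each to its negative. -/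
theorem sum_twistedBlock_odd {M : Type*} [AddCommGroup M] [Module ℝ M]
    {F : Matrix (Fin d) (Fin p) ℝ → M} (hF : ∀ X, F (-X) = -F X) :
    ∑ i, F (twistedBlock d p i) = 0 := by
  rw [sum_twistedBlock]
  let e : Equiv.Perm (Fin d → Fin 2) :=
    Function.Involutive.toPerm (fun σ a => (σ a).rev) fun σ => by simp
  have he : ∀ σ, e σ = fun a => (σ a).rev := fun σ => rfl
  have hneg : ∀ (σ : Fin d → Fin 2) (k : Fin p),
      signedShift p (e σ) k = -signedShift p σ k := by
    intro σ k
    simp only [signedShift, he, neg_one_pow_rev,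
      ← Matrix.neg_mul, Matrix.diagonal_neg]
  have hsum := Equiv.sum_comp e
    fun σ : Fin d → Fin 2 => ∑ k : Fin p, F (signedShift p σ k)
  simp only [hneg, hF, Finset.sum_neg_distrib] at hsum
  have h2 := add_eq_zero_iff_eq_neg.mpr hsum.symm
  rw [← two_smul ℝ] at h2
  exact (smul_eq_zero.mp h2).resolve_left two_ne_zero

theorem sum_transpose_mul_twistedBlock (hp : d ≤ p) :
    ∑ i, (twistedBlock d p i)ᵀ * twistedBlock d p i = ((2 : ℝ) ^ d * d) • 1 := by
  rw [sum_twistedBlock fun T => Tᵀ * T]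
  ext b c
  simp only [Matrix.sum_apply, Matrix.mul_apply, Matrix.transpose_apply, signedShift_apply hp,
    ite_mul, zero_mul, mul_ite, mul_zero]
  simp only [← pow_add, ← two_mul, even_two, Even.mul_right, Even.neg_pow, one_pow]
  rw [Finset.sum_congr rfl fun σ _ => Finset.sum_comm]
  have : ∀ a : Fin d, (∑ k : Fin p, if c = shiftColumn hp a k then
      (if b = shiftColumn hp a k then (1 : ℝ) else 0) else 0) = if b = c then 1 else 0 := by
    intro a
    rw [(shiftColumn_bijective_right hp a).sum_comp
      fun j => if c = j then (if b = j then (1 : ℝ) else 0) else 0]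
    simp
  simp only [this]
  simp [Matrix.one_apply]

/-- Averaging over signs removes the terms with `a ≠ b`; over the shifts, row `a` then meets each
column exactly once. -/
theorem sum_trace_mul_twistedBlock_sq (hp : d ≤ p) (Y : Matrix (Fin d) (Fin p) ℝ) :
    ∑ i, (Y * (twistedBlock d p i)ᵀ * (Y * (twistedBlock d p i)ᵀ)).trace =
      2 ^ d * (Yᵀ * Y).trace := by
  have h0 := sum_twistedBlock fun T : Matrix (Fin d) (Fin p) ℝ => (Y * Tᵀ * (Y * Tᵀ)).trace
  rw [h0, trace_transpose_mul_self]
  have h : ∀ (σ : Fin d → Fin 2) (k : Fin p) (a b : Fin d),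
      (Y * (signedShift p σ k)ᵀ) a b = Y a (shiftColumn hp b k) * (-1) ^ (σ b : ℕ) := by
    intro σ k a b
    simp [Matrix.mul_apply, signedShift_apply hp]
  have h1 : ∀ B : Matrix (Fin d) (Fin d) ℝ, (B * B).trace = ∑ a, ∑ b, B a b * B b a := by
    simp [Matrix.trace, Matrix.mul_apply]
  simp only [h1, h]
  have h2 : ∀ (σ : Fin d → Fin 2) (k : Fin p) (a b : Fin d),
      Y a (shiftColumn hp b k) * (-1) ^ (σ b : ℕ) *
        (Y b (shiftColumn hp a k) * (-1) ^ (σ a : ℕ)) =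
      Y a (shiftColumn hp b k) * Y b (shiftColumn hp a k) *
        ((-1) ^ (σ a : ℕ) * (-1) ^ (σ b : ℕ)) := fun σ k a b => by ring
  simp only [h2]
  rw [Finset.sum_comm]
  have h3 : ∀ k : Fin p, ∑ σ : Fin d → Fin 2, ∑ a, ∑ b,
      Y a (shiftColumn hp b k) * Y b (shiftColumn hp a k) *
        ((-1) ^ (σ a : ℕ) * (-1) ^ (σ b : ℕ)) =
      ∑ a, 2 ^ d * Y a (shiftColumn hp a k) ^ 2 := by
    intro k
    rw [Finset.sum_comm]
    refine Finset.sum_congr rfl fun a _ => ?_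
    rw [Finset.sum_comm]
    simp only [← Finset.mul_sum, sum_sign_mul_sign]
    simp
    ring
  simp only [h3]
  rw [Finset.sum_comm, Finset.mul_sum]
  refine Finset.sum_congr rfl fun a _ => ?_
  rw [(shiftColumn_bijective_right hp a).sum_comp fun j => 2 ^ d * Y a j ^ 2, Finset.mul_sum]

end twisted

/-! ### Pythagoras for the projectors onto the columns of `Z` and `S`. -/

section projector
variable {m : Type*} [Fintype m] {d p : ℕ} {ν β : ℝ} {Z : Matrix m (Fin d) ℝ}
  {S : Matrix m (Fin p) ℝ}

theorem trace_transpose_mul_self_sub_projection (hν : ν ≠ 0) (hβ : β ≠ 0)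
    (hZ : Zᵀ * Z = ν • 1) (hS : Sᵀ * S = β⁻¹ • 1) (hZS : Zᵀ * S = 0) {q : Type*} [Fintype q]
    (X : Matrix m q ℝ) :
    ((X - ν⁻¹ • (Z * (Zᵀ * X)) - β • (S * (Sᵀ * X)))ᵀ *
      (X - ν⁻¹ • (Z * (Zᵀ * X)) - β • (S * (Sᵀ * X)))).trace =
      (Xᵀ * X).trace - ν⁻¹ * ((Zᵀ * X)ᵀ * (Zᵀ * X)).trace -
        β * ((Sᵀ * X)ᵀ * (Sᵀ * X)).trace := by
  have hSZ : Sᵀ * Z = 0 := by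
    have := congrArg Matrix.transpose hZS
    simpa using this
  have hZ' : ∀ M : Matrix (Fin d) q ℝ, Zᵀ * (Z * M) = ν • M := fun M => by
    rw [← Matrix.mul_assoc, hZ, Matrix.smul_mul, Matrix.one_mul]
  have hS' : ∀ M : Matrix (Fin p) q ℝ, Sᵀ * (S * M) = β⁻¹ • M := fun M => by
    rw [← Matrix.mul_assoc, hS, Matrix.smul_mul, Matrix.one_mul]
  have hZS' : ∀ M : Matrix (Fin p) q ℝ, Zᵀ * (S * M) = 0 := fun M => by
    rw [← Matrix.mul_assoc, hZS, Matrix.zero_mul]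
  have hSZ' : ∀ M : Matrix (Fin d) q ℝ, Sᵀ * (Z * M) = 0 := fun M => by
    rw [← Matrix.mul_assoc, hSZ, Matrix.zero_mul]
  simp only [Matrix.transpose_sub, Matrix.transpose_smul, Matrix.transpose_mul,
    Matrix.transpose_transpose, Matrix.mul_sub, Matrix.sub_mul, Matrix.smul_mul, Matrix.mul_smul,
    Matrix.mul_assoc, hZ', hS', hZS', hSZ', Matrix.trace_sub, Matrix.trace_smul, smul_eq_mul,
    Matrix.mul_zero, Matrix.trace_zero]
  field_simp
  ring

end projector

/-- The averaging identities satisfied by the blocks of a twisted state. -/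
structure IsBalanced {n d p : ℕ} (T : Fin n → Matrix (Fin d) (Fin p) ℝ) : Prop where
  mul_transpose : ∀ i, T i * (T i)ᵀ = 1
  sum_eq_zero : ∑ i, T i = 0
  sum_gram : ∑ i, (T i)ᵀ * T i = ((n : ℝ) * d / p) • 1
  sum_trace_sq : ∀ Y : Matrix (Fin d) (Fin p) ℝ,
    ∑ i, (Y * (T i)ᵀ * (Y * (T i)ᵀ)).trace = (n : ℝ) / p * (Yᵀ * Y).trace
  sum_cubic : ∀ Y : Matrix (Fin d) (Fin p) ℝ, ∑ i, (T i)ᵀ * (symPart (T i) Y * T i) = 0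

theorem isBalanced_twistedBlock {d p : ℕ} (hd : 1 ≤ d) (hp : d ≤ p) :
    IsBalanced (twistedBlock d p) := by
  have hp0 : (p : ℝ) ≠ 0 := by
    have : 0 < p := by omega
    positivity
  refine ⟨twistedBlock_mul_transpose hp, ?_, ?_, fun Y => ?_, fun Y => ?_⟩
  · exact sum_twistedBlock_odd (F := fun X => X) fun X => rfl
  · rw [sum_transpose_mul_twistedBlock hp]
    push_cast
    congr 1
    field_simp
  · rw [sum_trace_mul_twistedBlock_sq hp]
    push_cast
    field_simp
  · refine sum_twistedBlock_odd (F := fun X => Xᵀ * (symPart X Y * X)) fun X => ?_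
    have : symPart (-X) Y = -symPart X Y := by
      simp only [symPart, Matrix.transpose_neg, Matrix.mul_neg, Matrix.neg_mul]
      module
    simp [this]

/-! ### Spectrum of the twisted Laplacian and the tangent inequality. -/

section twistedState
variable {n d p : ℕ} {T : Fin n → Matrix (Fin d) (Fin p) ℝ}
  {Z : Matrix (Fin n × Fin d) (Fin d) ℝ} {S : Matrix (Fin n × Fin d) (Fin p) ℝ}

theorem IsBalanced.mem_stiefel (hT : IsBalanced T) (hZ : Z ∈ Stiefel n d d)
    (hS : ∀ i, block S i = block Z i * T i) : S ∈ Stiefel n d p := by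
  intro i
  rw [hS, Matrix.transpose_mul, Matrix.mul_assoc, mul_transpose_mul_cancel (hT.mul_transpose i)]
  exact hZ i

theorem transpose_mul_stack_rotated (hZ : Z ∈ Stiefel n d d) {q r : ℕ}
    {X : Matrix (Fin n × Fin d) (Fin q) ℝ} {Y : Matrix (Fin n × Fin d) (Fin r) ℝ}
    {F : Fin n → Matrix (Fin d) (Fin q) ℝ} {G : Fin n → Matrix (Fin d) (Fin r) ℝ}
    (hX : ∀ i, block X i = block Z i * F i) (hY : ∀ i, block Y i = block Z i * G i) :
    Xᵀ * Y = ∑ i, (F i)ᵀ * G i := by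
  rw [transpose_mul_eq_sum_block]
  refine Finset.sum_congr rfl fun i _ => ?_
  rw [hX, hY, Matrix.transpose_mul, Matrix.mul_assoc, ← Matrix.mul_assoc (block Z i)ᵀ,
    transpose_mul_block_of_orthogonal hZ, Matrix.one_mul]

theorem IsBalanced.transpose_mul (hT : IsBalanced T) (hZ : Z ∈ Stiefel n d d)
    (hS : ∀ i, block S i = block Z i * T i) : Zᵀ * S = 0 := by
  rw [transpose_mul_stack_rotated hZ (F := fun _ => 1) (fun i => (Matrix.mul_one _).symm) hS]
  simp [hT.sum_eq_zero]

theorem IsBalanced.gram (hT : IsBalanced T) (hZ : Z ∈ Stiefel n d d)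
    (hS : ∀ i, block S i = block Z i * T i) : Sᵀ * S = ((p : ℝ) / (n * d))⁻¹ • 1 := by
  rw [transpose_mul_stack_rotated hZ hS hS, hT.sum_gram, inv_div]

theorem twistedLaplacian_transpose (Z : Matrix (Fin n × Fin d) (Fin d) ℝ)
    (S : Matrix (Fin n × Fin d) (Fin p) ℝ) :
    (twistedLaplacian Z S)ᵀ = twistedLaplacian Z S := by
  simp [twistedLaplacian]

theorem twistedLaplacian_mul {q : Type*} (X : Matrix (Fin n × Fin d) q ℝ) :
    twistedLaplacian Z S * X = (2 * (p : ℝ) / (d + 1)) • (X - (n : ℝ)⁻¹ • (Z * (Zᵀ * X))) -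
      ((2 * (p : ℝ) / (d + 1) - 1) * ((p : ℝ) / (n * d))) • (S * (Sᵀ * X)) := by
  simp [twistedLaplacian, Matrix.sub_mul, Matrix.mul_assoc]

theorem trace_quadratic_twistedLaplacian {q : Type*} [Fintype q]
    (X : Matrix (Fin n × Fin d) q ℝ) :
    (Xᵀ * (twistedLaplacian Z S * X)).trace =
      (2 * (p : ℝ) / (d + 1)) *
        ((Xᵀ * X).trace - (n : ℝ)⁻¹ * ((Zᵀ * X)ᵀ * (Zᵀ * X)).trace) -
      (2 * (p : ℝ) / (d + 1) - 1) * (((p : ℝ) / (n * d)) * ((Sᵀ * X)ᵀ * (Sᵀ * X)).trace) := by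
  rw [twistedLaplacian_mul]
  simp only [Matrix.mul_sub, Matrix.mul_smul, Matrix.trace_sub, Matrix.trace_smul, smul_eq_mul,
    Matrix.transpose_mul, Matrix.transpose_transpose, Matrix.mul_assoc]
  ring

theorem twistedLaplacian_mul_self (hn : 0 < n) (hZ : Z ∈ Stiefel n d d) (hZS : Zᵀ * S = 0) :
    twistedLaplacian Z S * Z = 0 := by
  have hSZ : Sᵀ * Z = 0 := by
    have := congrArg Matrix.transpose hZS
    simpa using this
  have hn' : (n : ℝ) ≠ 0 := by positivity
  rw [twistedLaplacian_mul, hSZ, transpose_mul_self_of_orthogonal hZ]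
  simp [smul_smul, hn']

theorem twistedLaplacian_mul_twistedState (hn : 0 < n) (hd : 0 < d) (hp : 0 < p)
    (hZS : Zᵀ * S = 0) (hS : Sᵀ * S = ((p : ℝ) / (n * d))⁻¹ • 1) :
    twistedLaplacian Z S * S = S := by
  rw [twistedLaplacian_mul, hZS, hS]
  have h : (p : ℝ) / (n * d) ≠ 0 := by positivity
  simp only [Matrix.mul_zero, smul_zero, sub_zero, Matrix.mul_smul, Matrix.mul_one, smul_smul,
    mul_assoc, mul_inv_cancel₀ h]
  module

theorem one_le_ratio (hd : 1 ≤ d) (hp : d ≤ p) : 1 ≤ 2 * (p : ℝ) / (d + 1) := by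
  have hd' : (1 : ℝ) ≤ d := by exact_mod_cast hd
  have hp' : (d : ℝ) ≤ p := by exact_mod_cast hp
  rw [le_div_iff₀ (by positivity)]
  linarith

/-- The component of `X` orthogonal to the columns of `Z` and `S`. -/
noncomputable def residual {q : Type*} (Z : Matrix (Fin n × Fin d) (Fin d) ℝ)
    (S : Matrix (Fin n × Fin d) (Fin p) ℝ) (X : Matrix (Fin n × Fin d) q ℝ) :
    Matrix (Fin n × Fin d) q ℝ :=
  X - (n : ℝ)⁻¹ • (Z * (Zᵀ * X)) - ((p : ℝ) / (n * d)) • (S * (Sᵀ * X))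

theorem IsBalanced.trace_residual (hn : 0 < n) (hd : 0 < d) (hp : 0 < p) (hT : IsBalanced T)
    (hZ : Z ∈ Stiefel n d d) (hS : ∀ i, block S i = block Z i * T i) {q : Type*} [Fintype q]
    (X : Matrix (Fin n × Fin d) q ℝ) :
    ((residual Z S X)ᵀ * residual Z S X).trace =
      (Xᵀ * X).trace - (n : ℝ)⁻¹ * ((Zᵀ * X)ᵀ * (Zᵀ * X)).trace -
        ((p : ℝ) / (n * d)) * ((Sᵀ * X)ᵀ * (Sᵀ * X)).trace :=
  trace_transpose_mul_self_sub_projection (by positivity) (by positivity)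
    (transpose_mul_self_of_orthogonal hZ) (hT.gram hZ hS) (hT.transpose_mul hZ hS) X

/-- The spectral decomposition of `L`: eigenvalue `0` on the columns of `Z`, `1` on those of `S`,
`2p/(d+1)` on the rest. -/
theorem IsBalanced.trace_quadratic (hn : 0 < n) (hd : 0 < d) (hp : 0 < p) (hT : IsBalanced T)
    (hZ : Z ∈ Stiefel n d d) (hS : ∀ i, block S i = block Z i * T i) {q : Type*} [Fintype q]
    (X : Matrix (Fin n × Fin d) q ℝ) :
    (Xᵀ * (twistedLaplacian Z S * X)).trace =
      (2 * (p : ℝ) / (d + 1)) * ((residual Z S X)ᵀ * residual Z S X).trace +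
        ((p : ℝ) / (n * d)) * ((Sᵀ * X)ᵀ * (Sᵀ * X)).trace := by
  rw [hT.trace_residual hn hd hp hZ hS, trace_quadratic_twistedLaplacian]
  ring

theorem IsBalanced.posSemidef (hn : 0 < n) (hd : 0 < d) (hp : 0 < p) (hT : IsBalanced T)
    (hZ : Z ∈ Stiefel n d d) (hS : ∀ i, block S i = block Z i * T i) :
    (twistedLaplacian Z S).PosSemidef := by
  refine Matrix.PosSemidef.of_dotProduct_mulVec_nonneg (twistedLaplacian_transpose Z S)
    fun x => ?_
  have h := hT.trace_quadratic hn hd hp hZ hS (Matrix.replicateCol Unit x)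
  have h2 : star x ⬝ᵥ (twistedLaplacian Z S *ᵥ x) =
      ((Matrix.replicateCol Unit x)ᵀ * (twistedLaplacian Z S * Matrix.replicateCol Unit x)).trace := by
    rw [trace_transpose_mul]
    simp [dotProduct, Matrix.mulVec, Matrix.mul_apply]
  rw [h2, h]
  exact add_nonneg (mul_nonneg (by positivity) (trace_transpose_mul_self_nonneg _))
    (mul_nonneg (by positivity) (trace_transpose_mul_self_nonneg _))

theorem IsBalanced.kthEigenvalue_eq_one (hn : 2 ≤ n) (hd : 1 ≤ d) (hp : d ≤ p)
    (hT : IsBalanced T) (hZ : Z ∈ Stiefel n d d) (hS : ∀ i, block S i = block Z i * T i) :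
    kthEigenvalue (twistedLaplacian Z S) (d + 1) = 1 := by
  have hH : (twistedLaplacian Z S).IsHermitian := twistedLaplacian_transpose Z S
  have hc := one_le_ratio hd hp
  have hp0 : 0 < p := by omega
  have hge : 1 ≤ kthEigenvalue (twistedLaplacian Z S) (d + 1) := by
    refine le_kthEigenvalue_of_le_trace_quadratic hH ?_ Z 1 fun X hX => ?_
    · simp only [Fintype.card_prod, Fintype.card_fin]
      nlinarith
    · have h1 := hT.trace_residual (by omega) hd hp0 hZ hS X
      have h2 := trace_transpose_mul_self_nonneg (residual Z S X)
      rw [hT.trace_quadratic (by omega) hd hp0 hZ hS X]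
      rw [hX] at h1
      simp only [Matrix.transpose_zero, Matrix.mul_zero, Matrix.trace_zero, mul_zero,
        sub_zero] at h1
      nlinarith
  refine le_antisymm ?_ hge
  have hn0 : (0 : ℝ) < n := by
    have : 0 < n := by omega
    exact_mod_cast this
  have h := kthEigenvalue_mul_le_trace_quadratic hH hn0.ne' (transpose_mul_self_of_orthogonal hZ)
    (twistedLaplacian_mul_self (by omega) hZ (hT.transpose_mul hZ hS)) (by linarith)
    (hT.transpose_mul hZ hS)
  rw [twistedLaplacian_mul_twistedState (by omega) hd hp0 (hT.transpose_mul hZ hS)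
    (hT.gram hZ hS), trace_transpose_mul_self_of_mem_stiefel (hT.mem_stiefel hZ hS)] at h
  have hd0 : (0 : ℝ) < d := by exact_mod_cast hd
  nlinarith [mul_pos hn0 hd0]

theorem IsBalanced.trace_residual_one (hn : 0 < n) (hd : 0 < d) (hp : 0 < p) (hT : IsBalanced T)
    (hZ : Z ∈ Stiefel n d d) (hS : ∀ i, block S i = block Z i * T i) :
    ((residual Z S (1 : Matrix (Fin n × Fin d) (Fin n × Fin d) ℝ))ᵀ * residual Z S 1).trace =
      (n : ℝ) * d - d - p := by
  rw [hT.trace_residual hn hd hp hZ hS]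
  simp only [Matrix.mul_one, Matrix.transpose_transpose, Matrix.transpose_one, Matrix.trace_one,
    Fintype.card_prod, Fintype.card_fin]
  rw [Matrix.trace_mul_comm Z, Matrix.trace_mul_comm S,
    trace_transpose_mul_self_of_mem_stiefel (hT.mem_stiefel hZ hS),
    trace_transpose_mul_self_of_mem_stiefel hZ]
  push_cast
  field_simp

theorem IsBalanced.maxEigenvalue_eq (hn : 2 ≤ n) (hd : 1 ≤ d) (hp : d ≤ p)
    (hT : IsBalanced T) (hZ : Z ∈ Stiefel n d d) (hS : ∀ i, block S i = block Z i * T i)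
    (hdim : d + p < n * d ∨ 2 * (p : ℝ) / (d + 1) = 1) :
    maxEigenvalue (twistedLaplacian Z S) = 2 * (p : ℝ) / (d + 1) := by
  have hH : (twistedLaplacian Z S).IsHermitian := twistedLaplacian_transpose Z S
  have hc := one_le_ratio hd hp
  have hp0 : 0 < p := by omega
  have hcard : d + 1 ≤ Fintype.card (Fin n × Fin d) := by
    simp only [Fintype.card_prod, Fintype.card_fin]
    nlinarith
  refine le_antisymm (maxEigenvalue_le_of_trace_quadratic_le hH (by omega) _ fun X => ?_) ?_
  · rw [trace_quadratic_twistedLaplacian]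
    have h1 : 0 ≤ (n : ℝ)⁻¹ * ((Zᵀ * X)ᵀ * (Zᵀ * X)).trace :=
      mul_nonneg (by positivity) (trace_transpose_mul_self_nonneg _)
    have h2 : 0 ≤ ((p : ℝ) / (n * d)) * ((Sᵀ * X)ᵀ * (Sᵀ * X)).trace :=
      mul_nonneg (by positivity) (trace_transpose_mul_self_nonneg _)
    nlinarith [mul_nonneg (sub_nonneg.mpr hc) h2]
  · rcases hdim with hdim | hdim
    -- `E` is the projector onto the complement of both column spaces. Its trace `nd - d - p` is
    -- positive, so it is a nonzero test matrix for the top eigenvalue.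
    · set E := residual Z S (1 : Matrix (Fin n × Fin d) (Fin n × Fin d) ℝ) with hE
      have htr := hT.trace_residual_one (by omega) hd hp0 hZ hS
      have hpos : 0 < (Eᵀ * E).trace := by
        rw [htr]
        have : (d : ℝ) + p < n * d := by exact_mod_cast hdim
        linarith
      have hgZ := transpose_mul_self_of_orthogonal hZ
      have hgS := hT.gram hZ hS
      have hZS := hT.transpose_mul hZ hS
      have hSZ : Sᵀ * Z = 0 := by
        have := congrArg Matrix.transpose hZS
        simpa using this
      have hn' : (n : ℝ) ≠ 0 := by positivity
      have hβ : (p : ℝ) / (n * d) ≠ 0 := by positivity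
      have hZE : Zᵀ * E = 0 := by
        rw [hE, residual]
        simp only [Matrix.mul_one, Matrix.mul_sub, Matrix.mul_smul, ← Matrix.mul_assoc, hgZ, hZS,
          Matrix.zero_mul, smul_zero, Matrix.smul_mul, Matrix.one_mul, smul_smul,
          inv_mul_cancel₀ hn', one_smul, sub_self]
      have hSE : Sᵀ * E = 0 := by
        rw [hE, residual]
        simp only [Matrix.mul_one, Matrix.mul_sub, Matrix.mul_smul, ← Matrix.mul_assoc, hgS, hSZ,
          Matrix.zero_mul, smul_zero, Matrix.smul_mul, Matrix.one_mul, smul_smul,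
          mul_inv_cancel₀ hβ, one_smul, sub_self, sub_zero]
      have h := trace_quadratic_le_maxEigenvalue hH E
      rw [trace_quadratic_twistedLaplacian, hZE, hSE] at h
      simp only [Matrix.mul_zero, Matrix.trace_zero, mul_zero, sub_zero] at h
      exact le_of_mul_le_mul_right h hpos
    · rw [hdim, ← hT.kthEigenvalue_eq_one hn hd hp hZ hS]
      exact kthEigenvalue_le_maxEigenvalue hH (by omega) hcard

theorem IsBalanced.trace_le_trace_quadratic_of_tangent (hn : 0 < n) (hd : 1 ≤ d) (hp : d ≤ p)
    (hT : IsBalanced T) (hZ : Z ∈ Stiefel n d d) (hS : ∀ i, block S i = block Z i * T i)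
    {V : Matrix (Fin n × Fin d) (Fin p) ℝ}
    (hV : ∀ i, block V i * (block S i)ᵀ + block S i * (block V i)ᵀ = 0) :
    (Vᵀ * V).trace ≤ (Vᵀ * (twistedLaplacian Z S * V)).trace := by
  have hc := one_le_ratio hd hp
  have hp0 : 0 < p := by omega
  have hp' : (0 : ℝ) < p := by exact_mod_cast hp0
  have hn' : (0 : ℝ) < n := by exact_mod_cast hn
  have hd' : (0 : ℝ) < d := by exact_mod_cast hd
  set c : ℝ := 2 * (p : ℝ) / (d + 1) with hcdef
  set β : ℝ := (p : ℝ) / (n * d) with hβ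
  let v : Fin n → Matrix (Fin d) (Fin p) ℝ := fun i => (block Z i)ᵀ * block V i
  have hVv : ∀ i, block V i = block Z i * v i := fun i => by
    rw [← Matrix.mul_assoc, hZ i, Matrix.one_mul]
  have hskew : ∀ i, v i * (T i)ᵀ + T i * (v i)ᵀ = 0 := by
    intro i
    have h1 := congrArg (fun M => (block Z i)ᵀ * M * block Z i) (hV i)
    have h2 := transpose_mul_block_of_orthogonal hZ i
    have h3 : ∀ {q : ℕ} (M : Matrix (Fin d) (Fin q) ℝ), (block Z i)ᵀ * (block Z i * M) = M :=
      fun M => by rw [← Matrix.mul_assoc, h2, Matrix.one_mul]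
    simpa only [hVv, hS, Matrix.transpose_mul, Matrix.mul_add, Matrix.add_mul, Matrix.mul_assoc,
      h3, h2, Matrix.mul_one, Matrix.mul_zero, Matrix.zero_mul] using h1
  set Y : Matrix (Fin d) (Fin p) ℝ := (n : ℝ)⁻¹ • (Zᵀ * V) with hY
  set N : ℝ := n * (Yᵀ * Y).trace with hN
  have hZV : Zᵀ * V = (n : ℝ) • Y := by rw [hY, smul_smul, mul_inv_cancel₀ hn'.ne', one_smul]
  have hZVsum : ∑ i, v i = (n : ℝ) • Y := by
    rw [← hZV, transpose_mul_stack_rotated hZ (F := fun _ => 1) (fun i => (Matrix.mul_one _).symm)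
      hVv]
    simp
  -- Blockwise, minus the tangent projection of `Y`; the vector `U` built from it is the
  -- Cauchy–Schwarz partner of `V`.
  let u : Fin n → Matrix (Fin d) (Fin p) ℝ := fun i => symPart (T i) Y * T i - (1 : ℝ) • Y
  let U : Matrix (Fin n × Fin d) (Fin p) ℝ := stack fun i => block Z i * u i
  have hU : ∀ i, block U i = block Z i * u i := fun i => rfl
  have hVU : (Vᵀ * U).trace = -N := by
    -- Tangency makes `v i * (T i)ᵀ` skew, and its pairing with a symmetric matrix vanishes.
    have h0 : ∀ i, ((v i)ᵀ * (symPart (T i) Y * T i)).trace = 0 := by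
      intro i
      have h1 : ((v i)ᵀ * (symPart (T i) Y * T i)).trace =
          (symPart (T i) Y * (T i * (v i)ᵀ)).trace := by
        rw [Matrix.trace_mul_comm, Matrix.mul_assoc]
      have h2 : (symPart (T i) Y * (T i * (v i)ᵀ)).trace =
          (symPart (T i) Y * (v i * (T i)ᵀ)).trace := by
        rw [← Matrix.trace_transpose, Matrix.transpose_mul, symPart_transpose,
          Matrix.trace_mul_comm]
        simp
      have h3 := congrArg (fun M => (symPart (T i) Y * M).trace) (hskew i)
      simp only [Matrix.mul_add, Matrix.trace_add, Matrix.mul_zero, Matrix.trace_zero] at h3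
      linarith
    rw [transpose_mul_stack_rotated hZ hVv hU, Matrix.trace_sum]
    simp only [u, Matrix.mul_sub, Matrix.trace_sub, h0, zero_sub, one_smul,
      Finset.sum_neg_distrib]
    rw [← Matrix.trace_sum, ← Matrix.sum_mul, ← Matrix.transpose_sum, hZVsum]
    simp [hN]
  have hSU : Sᵀ * U = 0 := by
    rw [transpose_mul_stack_rotated hZ hS hU]
    simp only [u, Matrix.mul_sub, Finset.sum_sub_distrib, hT.sum_cubic, one_smul,
      ← Matrix.sum_mul, ← Matrix.transpose_sum, hT.sum_eq_zero]
    simp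
  have hUU : (Uᵀ * U).trace = N * (1 - 1 / c) := by
    have h1 : ∀ i, ((u i)ᵀ * u i).trace = (Yᵀ * Y).trace -
        1 / 2 * (Y * (T i)ᵀ * (Y * (T i)ᵀ)).trace - 1 / 2 * (Y * ((T i)ᵀ * T i) * Yᵀ).trace := by
      intro i
      rw [Matrix.trace_mul_comm, symPart_residual_mul_transpose (hT.mul_transpose i)]
      simp only [Matrix.trace_add, Matrix.trace_smul, smul_eq_mul]
      have h2 : (T i * (Yᵀ * T i * Yᵀ)).trace = (Y * (T i)ᵀ * (Y * (T i)ᵀ)).trace := by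
        rw [← Matrix.trace_transpose]
        simp only [Matrix.transpose_mul, Matrix.transpose_transpose, Matrix.mul_assoc]
      have h3 : (T i * (Yᵀ * Y) * (T i)ᵀ).trace = (Y * ((T i)ᵀ * T i) * Yᵀ).trace := by
        rw [Matrix.trace_mul_comm, ← Matrix.mul_assoc, ← Matrix.mul_assoc,
          Matrix.trace_mul_comm]
        simp only [Matrix.mul_assoc]
      have h4 : (Y * Yᵀ).trace = (Yᵀ * Y).trace := Matrix.trace_mul_comm _ _
      have h5 : (Y * (T i)ᵀ * Y * (T i)ᵀ).trace = (Y * (T i)ᵀ * (Y * (T i)ᵀ)).trace := by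
        simp only [Matrix.mul_assoc]
      rw [h2, h3, h4, h5]
      ring
    rw [transpose_mul_stack_rotated hZ hU hU, Matrix.trace_sum]
    simp only [h1, Finset.sum_sub_distrib, ← Finset.mul_sum, hT.sum_trace_sq]
    have h2 : ∑ i, (Y * ((T i)ᵀ * T i) * Yᵀ).trace = (n : ℝ) * d / p * (Yᵀ * Y).trace := by
      rw [← Matrix.trace_sum, ← Matrix.sum_mul, ← Matrix.mul_sum, hT.sum_gram, Matrix.mul_smul,
        Matrix.smul_mul, Matrix.mul_one, Matrix.trace_smul, smul_eq_mul, Matrix.trace_mul_comm Y]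
    rw [h2, Finset.sum_const, Finset.card_univ, Fintype.card_fin, nsmul_eq_mul, hN, hcdef]
    field_simp
    ring
  set q : ℝ := (Vᵀ * V).trace - β * ((Sᵀ * V)ᵀ * (Sᵀ * V)).trace with hq
  have hβ0 : β ≠ 0 := by positivity
  -- The right side is `‖s (V - P_S V) + U‖²`. Since `Sᵀ U = 0`, removing `P_S V` leaves the cross
  -- term at `-N` and lowers `‖V‖²` to `q`.
  have hquad : ∀ s : ℝ, 0 ≤ q * (s * s) + 2 * N * s * (-1) + N * (1 - 1 / c) := by
    intro s
    have h := trace_transpose_mul_self_nonneg (s • (V - β • (S * (Sᵀ * V))) + U)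
    have hUV : (Uᵀ * V).trace = -N := by
      rw [← hVU, ← Matrix.trace_transpose, Matrix.transpose_mul, Matrix.transpose_transpose]
    have hUS : Uᵀ * S = 0 := by
      have := congrArg Matrix.transpose hSU
      simpa using this
    have hUS' : Uᵀ * (S * (Sᵀ * V)) = 0 := by
      rw [← Matrix.mul_assoc, hUS, Matrix.zero_mul]
    have hSS : Sᵀ * (S * (Sᵀ * V)) = β⁻¹ • (Sᵀ * V) := by
      rw [← Matrix.mul_assoc, hT.gram hZ hS, Matrix.smul_mul, Matrix.one_mul]
    simp only [Matrix.transpose_add, Matrix.transpose_smul, Matrix.transpose_sub,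
      Matrix.transpose_mul, Matrix.transpose_transpose, Matrix.mul_add, Matrix.add_mul,
      Matrix.mul_sub, Matrix.sub_mul, Matrix.mul_smul, Matrix.smul_mul, Matrix.mul_assoc,
      Matrix.trace_add, Matrix.trace_sub, Matrix.trace_smul, smul_eq_mul, hUS', hSU, hSS,
      hVU, hUV, hUU, Matrix.mul_zero, Matrix.trace_zero] at h
    have h2 : q = (Vᵀ * V).trace - β * (Vᵀ * (S * (Sᵀ * V))).trace := by
      rw [hq, Matrix.transpose_mul, Matrix.transpose_transpose, Matrix.mul_assoc]
    have h3 : β * β⁻¹ = 1 := mul_inv_cancel₀ hβ0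
    rw [h2]
    convert h using 1
    field_simp
    ring
  have hdisc := discrim_le_zero (a := q) (b := -2 * N) (c := N * (1 - 1 / c)) fun s => by
    have := hquad s
    linarith
  rw [discrim] at hdisc
  have hN0 : 0 ≤ N := mul_nonneg hn'.le (trace_transpose_mul_self_nonneg _)
  have hc0 : 0 < c := by linarith
  have hq0 : 0 ≤ q := by
    have h := hT.trace_residual hn hd hp0 hZ hS V
    have h1 := trace_transpose_mul_self_nonneg (residual Z S V)
    have h2 : 0 ≤ (n : ℝ)⁻¹ * ((Zᵀ * V)ᵀ * (Zᵀ * V)).trace :=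
      mul_nonneg (by positivity) (trace_transpose_mul_self_nonneg _)
    linarith
  have hkey : c * N ≤ (c - 1) * q := by
    have h1 : c * (1 - 1 / c) = c - 1 := by field_simp
    -- The discriminant gives `N² ≤ q N (1 - 1/c)`, from which `N` can be cancelled only if it is
    -- nonzero.
    rcases hN0.eq_or_lt with h | h
    · rw [← h, mul_zero]
      exact mul_nonneg (by linarith) hq0
    · have h2 : N ≤ q * (1 - 1 / c) := by nlinarith
      calc c * N ≤ c * (q * (1 - 1 / c)) := by gcongr
        _ = (c - 1) * q := by rw [← h1]; ring
  have hZVtr : (n : ℝ)⁻¹ * ((Zᵀ * V)ᵀ * (Zᵀ * V)).trace = N := by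
    rw [hZV, Matrix.transpose_smul, Matrix.smul_mul, Matrix.mul_smul, Matrix.trace_smul,
      Matrix.trace_smul, smul_eq_mul, smul_eq_mul, ← mul_assoc, inv_mul_cancel₀ hn'.ne', one_mul]
  rw [trace_quadratic_twistedLaplacian, hZVtr]
  rw [hq] at hkey
  linarith

end twistedState

/-! ### Criticality of the twisted state and global minimizers. -/

section
variable {n d p : ℕ} {T : Fin n → Matrix (Fin d) (Fin p) ℝ}
  {Z : Matrix (Fin n × Fin d) (Fin d) ℝ} {S : Matrix (Fin n × Fin d) (Fin p) ℝ}

theorem IsBalanced.isSecondOrderCritical (hn : 0 < n) (hd : 1 ≤ d) (hp : d ≤ p)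
    (hT : IsBalanced T) (hZ : Z ∈ Stiefel n d d) (hS : ∀ i, block S i = block Z i * T i)
    {A : Matrix (Fin n × Fin d) (Fin n × Fin d) ℝ}
    (hA : certificate A Z = twistedLaplacian Z S) : IsSecondOrderCritical A S := by
  have hSmem := hT.mem_stiefel hZ hS
  have hLS := twistedLaplacian_mul_twistedState hn (by omega) (by omega) (hT.transpose_mul hZ hS)
    (hT.gram hZ hS)
  refine ⟨hSmem, fun c hc hmem hc0 => ?_⟩
  let c₁ : ℝ → Matrix (Fin n × Fin d) (Fin p) ℝ := fun t =>
    Matrix.of fun x b => deriv (fun s => c s x b) t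
  let c₂ : Matrix (Fin n × Fin d) (Fin p) ℝ := Matrix.of fun x b => deriv (fun s => c₁ s x b) 0
  have h₁ : ∀ s x k, HasDerivAt (fun s => c s x k) (c₁ s x k) s := fun s x k =>
    ((hc x k).differentiable (by simp)).differentiableAt.hasDerivAt
  have h₂ : ∀ x k, HasDerivAt (fun s => c₁ s x k) (c₂ x k) 0 := fun x k =>
    (((contDiff_infty_iff_deriv.mp (hc x k)).2).differentiable
      (by simp)).differentiableAt.hasDerivAt
  have hLt := twistedLaplacian_transpose Z S
  -- Differentiating the constant `‖c‖²` twice gives `⟨c₂, S⟩ = -‖c₁ 0‖²`. As `L S = S`, this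
  -- evaluates the acceleration term without knowing `c₂`.
  have hconst : (fun t => ((c t)ᵀ * ((1 : Matrix (Fin n × Fin d) (Fin n × Fin d) ℝ) * c t)).trace) =
      fun _ => (n : ℝ) * d := funext fun t => by
    rw [Matrix.one_mul, trace_transpose_mul_self_of_mem_stiefel (hmem t)]
  have hfirst : ((c₁ 0)ᵀ * S).trace = 0 := by
    have h := hasDerivAt_trace_quadratic Matrix.transpose_one (h₁ 0)
    rw [hconst, Matrix.one_mul, hc0] at h
    have := h.unique (hasDerivAt_const (0 : ℝ) _)
    linarith
  have hsecond : (c₂ᵀ * S).trace + ((c₁ 0)ᵀ * c₁ 0).trace = 0 := by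
    have h := iteratedDeriv_two_trace_quadratic Matrix.transpose_one h₁ h₂
    rw [hconst, Matrix.one_mul, Matrix.one_mul, hc0] at h
    have h0 : iteratedDeriv 2 (fun _ : ℝ => (n : ℝ) * d) 0 = 0 := by
      simp [iteratedDeriv_succ, iteratedDeriv_zero]
    linarith
  have htan : ∀ i, block (c₁ 0) i * (block S i)ᵀ + block S i * (block (c₁ 0) i)ᵀ = 0 := by
    intro i
    ext a b
    have h : HasDerivAt (fun t => ∑ k, c t (i, a) k * c t (i, b) k)
        (∑ k, (c₁ 0 (i, a) k * c 0 (i, b) k + c 0 (i, a) k * c₁ 0 (i, b) k)) 0 :=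
      HasDerivAt.fun_sum fun k _ => (h₁ 0 (i, a) k).mul (h₁ 0 (i, b) k)
    have hcst : (fun t => ∑ k, c t (i, a) k * c t (i, b) k) =
        fun _ => (1 : Matrix (Fin d) (Fin d) ℝ) a b :=
      funext fun t => congrFun (congrFun (hmem t i) a) b
    rw [hcst, hc0] at h
    have h0 := h.unique (hasDerivAt_const (0 : ℝ) _)
    rw [Finset.sum_add_distrib] at h0
    simpa [Matrix.mul_apply, block] using h0
  obtain ⟨hd1, hd2⟩ := deriv_objective_comp A Z hmem
  rw [hd1, hd2, hA, iteratedDeriv_two_trace_quadratic hLt h₁ h₂,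
    (hasDerivAt_trace_quadratic hLt (h₁ 0)).deriv, hc0, hLS]
  have := hT.trace_le_trace_quadratic_of_tangent hn hd hp hZ hS htan
  exact ⟨by linarith, by linarith⟩

theorem mul_frame_mem_stiefel (hp : d ≤ p) (hZ : Z ∈ Stiefel n d d) :
    Z * frame d p ∈ Stiefel n d p := by
  have hF : frame d p * (frame d p)ᵀ = 1 := by
    ext a b
    rw [Matrix.mul_apply, Finset.sum_eq_single (Fin.castLE hp a)]
    · simp [frame, Matrix.one_apply, Fin.ext_iff, eq_comm]
    · intro c _ hc
      have : (a : ℕ) ≠ c := fun h => hc (Fin.ext h.symm)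
      simp [frame, this]
    · simp
  intro i
  rw [block_mul, Matrix.transpose_mul, Matrix.mul_assoc, ← Matrix.mul_assoc (frame d p), hF,
    Matrix.one_mul, hZ i]

theorem IsBalanced.trace_quadratic_nonneg (hn : 0 < n) (hd : 0 < d) (hp : 0 < p)
    (hT : IsBalanced T) (hZ : Z ∈ Stiefel n d d) (hS : ∀ i, block S i = block Z i * T i)
    {q : Type*} [Fintype q] (X : Matrix (Fin n × Fin d) q ℝ) :
    0 ≤ (Xᵀ * (twistedLaplacian Z S * X)).trace := by
  rw [hT.trace_quadratic hn hd hp hZ hS]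
  exact add_nonneg (mul_nonneg (by positivity) (trace_transpose_mul_self_nonneg _))
    (mul_nonneg (by positivity) (trace_transpose_mul_self_nonneg _))

theorem eq_zero_of_trace_transpose_mul_self {m q : Type*} [Fintype m] [Fintype q]
    {X : Matrix m q ℝ} (hX : (Xᵀ * X).trace = 0) : X = 0 :=
  Matrix.trace_conjTranspose_mul_self_eq_zero_iff.mp (by simpa using hX)

/-- Both nonnegative terms of the spectral decomposition vanish, leaving only the component along
`Z`. -/
theorem IsBalanced.eq_mul_of_trace_quadratic_nonpos (hn : 0 < n) (hd : 0 < d) (hp : 0 < p)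
    (hT : IsBalanced T) (hZ : Z ∈ Stiefel n d d) (hS : ∀ i, block S i = block Z i * T i)
    {q : Type*} [Fintype q] {X : Matrix (Fin n × Fin d) q ℝ}
    (hX : (Xᵀ * (twistedLaplacian Z S * X)).trace ≤ 0) :
    X = Z * ((n : ℝ)⁻¹ • (Zᵀ * X)) := by
  rw [hT.trace_quadratic hn hd hp hZ hS] at hX
  have h1 := trace_transpose_mul_self_nonneg (residual Z S X)
  have h2 := trace_transpose_mul_self_nonneg (Sᵀ * X)
  have hc : 0 < 2 * (p : ℝ) / (d + 1) := by positivity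
  have hβ : 0 < (p : ℝ) / (n * d) := by positivity
  have h3 := mul_nonneg hc.le h1
  have h4 := mul_nonneg hβ.le h2
  have h5 : residual Z S X = 0 :=
    eq_zero_of_trace_transpose_mul_self
      ((mul_eq_zero.mp (le_antisymm (by linarith) h3)).resolve_left hc.ne')
  have h6 : Sᵀ * X = 0 :=
    eq_zero_of_trace_transpose_mul_self
      ((mul_eq_zero.mp (le_antisymm (by linarith) h4)).resolve_left hβ.ne')
  rw [residual, h6, Matrix.mul_zero, smul_zero, sub_zero, sub_eq_zero] at h5
  rw [Matrix.mul_smul]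
  exact h5

theorem IsBalanced.isMinOn (hn : 0 < n) (hd : 0 < d) (hp : d ≤ p)
    (hT : IsBalanced T) (hZ : Z ∈ Stiefel n d d) (hS : ∀ i, block S i = block Z i * T i)
    {A : Matrix (Fin n × Fin d) (Fin n × Fin d) ℝ}
    (hA : certificate A Z = twistedLaplacian Z S) :
    IsMinOn (objective A) (Stiefel n d p) (Z * frame d p) := by
  intro R hR
  have h := hT.trace_quadratic_nonneg hn hd (by omega) hZ hS R
  show objective A (Z * frame d p) ≤ objective A R
  rw [objective_eq A Z hR, objective_eq A Z (mul_frame_mem_stiefel hp hZ), hA,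
    ← Matrix.mul_assoc (twistedLaplacian Z S),
    twistedLaplacian_mul_self hn hZ (hT.transpose_mul hZ hS)]
  simpa using h

theorem mul_transpose_eq_of_eq_mul (hn : 0 < n) (hZ : Z ∈ Stiefel n d d)
    {R : Matrix (Fin n × Fin d) (Fin p) ℝ} (hR : R ∈ Stiefel n d p)
    {Q : Matrix (Fin d) (Fin p) ℝ} (h : R = Z * Q) : R * Rᵀ = Z * Zᵀ := by
  -- One block suffices: `Z_0 Q Qᵀ Z_0ᵀ = 1` with `Z_0` orthogonal.
  have hQ : Q * Qᵀ = 1 := by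
    have h1 := hR ⟨0, hn⟩
    rw [h, block_mul] at h1
    have h2 := transpose_mul_block_of_orthogonal hZ ⟨0, hn⟩
    have h3 := congrArg (fun M => (block Z ⟨0, hn⟩)ᵀ * M * block Z ⟨0, hn⟩) h1
    simp only [Matrix.transpose_mul, Matrix.mul_one, h2, Matrix.mul_assoc] at h3
    rwa [← Matrix.mul_assoc, h2, Matrix.one_mul] at h3
  rw [h, Matrix.transpose_mul, Matrix.mul_assoc, ← Matrix.mul_assoc Q, hQ, Matrix.one_mul]

theorem IsBalanced.mul_transpose_of_isMinOn (hn : 0 < n) (hd : 0 < d) (hp : d ≤ p)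
    (hT : IsBalanced T) (hZ : Z ∈ Stiefel n d d) (hS : ∀ i, block S i = block Z i * T i)
    {A : Matrix (Fin n × Fin d) (Fin n × Fin d) ℝ}
    (hA : certificate A Z = twistedLaplacian Z S) {R : Matrix (Fin n × Fin d) (Fin p) ℝ}
    (hR : R ∈ Stiefel n d p) (hmin : IsMinOn (objective A) (Stiefel n d p) R) :
    R * Rᵀ = Z * Zᵀ := by
  have hF := mul_frame_mem_stiefel hp hZ
  have h : objective A R ≤ objective A (Z * frame d p) := hmin hF
  rw [objective_eq A Z hR, objective_eq A Z hF, hA, ← Matrix.mul_assoc (twistedLaplacian Z S),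
    twistedLaplacian_mul_self hn hZ (hT.transpose_mul hZ hS), Matrix.zero_mul, Matrix.mul_zero,
    Matrix.trace_zero] at h
  exact mul_transpose_eq_of_eq_mul hn hZ hR
    (hT.eq_mul_of_trace_quadratic_nonpos hn hd (by omega) hZ hS (by linarith))

theorem certificate_neg {L : Matrix (Fin n × Fin d) (Fin n × Fin d) ℝ} (hLZ : L * Z = 0) :
    certificate (-L) Z = L := by
  have : BDG (0 : Matrix (Fin n × Fin d) (Fin n × Fin d) ℝ) = 0 := by
    ext x y
    simp [BDG]
  rw [certificate, ← Matrix.mul_assoc, Matrix.neg_mul, hLZ, neg_zero, Matrix.zero_mul, this,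
    zero_sub, neg_neg]

/-- The complement of the columns of `Z` and `S` is trivial only for `d = p = 1`; there the ratio is
`1`, and the columns of `S` already attain it. -/
theorem add_lt_two_pow_mul_or_ratio_eq_one (hd : 1 ≤ d) (hp : d ≤ p) :
    d + p < 2 ^ d * p * d ∨ 2 * (p : ℝ) / (d + 1) = 1 := by
  have h2 : 2 ≤ 2 ^ d := by
    calc 2 = 2 ^ 1 := rfl
      _ ≤ 2 ^ d := Nat.pow_le_pow_right (by norm_num) hd
  rcases Nat.eq_or_lt_of_le (hd.trans hp) with h | h
  · obtain rfl : p = 1 := h.symm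
    obtain rfl : d = 1 := by omega
    right
    norm_num
  · left
    have h3 : 2 * (p * d) ≤ 2 ^ d * (p * d) := Nat.mul_le_mul_right _ h2
    rw [mul_assoc]
    nlinarith

end

end StiefelSync

theorem theorem5 (d p : ℕ) (hd : 1 ≤ d) (hp : d ≤ p) :
    (∀ (n : ℕ) (A : Matrix (Fin n × Fin d) (Fin n × Fin d) ℝ)
        (Z : Matrix (Fin n × Fin d) (Fin d) ℝ),
      Z ∈ StiefelSync.Stiefel n d d →
      (StiefelSync.certificate A Z).PosSemidef →
      StiefelSync.certificate A Z * Z = 0 →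
      0 < StiefelSync.kthEigenvalue (StiefelSync.certificate A Z) (d + 1) →
      StiefelSync.maxEigenvalue (StiefelSync.certificate A Z) /
          StiefelSync.kthEigenvalue (StiefelSync.certificate A Z) (d + 1) <
        2 * (p : ℝ) / ((d : ℝ) + 1) →
      ∀ S ∈ StiefelSync.Stiefel n d p, Zᵀ * S = 0 →
        ¬ StiefelSync.IsSecondOrderCritical A S) ∧
    (∀ Z ∈ StiefelSync.Stiefel (2 ^ d * p) d d,
      ∀ (S : Matrix (Fin (2 ^ d * p) × Fin d) (Fin p) ℝ)
        (L : Matrix (Fin (2 ^ d * p) × Fin d) (Fin (2 ^ d * p) × Fin d) ℝ),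
      S = StiefelSync.twistedState Z →
      L = StiefelSync.twistedLaplacian Z S →
        S ∈ StiefelSync.Stiefel (2 ^ d * p) d p ∧
        Zᵀ * S = 0 ∧
        L.PosSemidef ∧
        L * Z = 0 ∧
        StiefelSync.maxEigenvalue L = 2 * (p : ℝ) / ((d : ℝ) + 1) ∧
        StiefelSync.kthEigenvalue L (d + 1) = 1 ∧
        StiefelSync.maxEigenvalue L / StiefelSync.kthEigenvalue L (d + 1) =
          2 * (p : ℝ) / ((d : ℝ) + 1) ∧
        StiefelSync.certificate (-L) Z = L ∧
        ∀ A : Matrix (Fin (2 ^ d * p) × Fin d) (Fin (2 ^ d * p) × Fin d) ℝ,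
          StiefelSync.certificate A Z = L →
            StiefelSync.IsSecondOrderCritical A S ∧
            Z * StiefelSync.frame d p ∈ StiefelSync.Stiefel (2 ^ d * p) d p ∧
            IsMinOn (StiefelSync.objective A) (StiefelSync.Stiefel (2 ^ d * p) d p)
              (Z * StiefelSync.frame d p) ∧
            ∀ R ∈ StiefelSync.Stiefel (2 ^ d * p) d p,
              IsMinOn (StiefelSync.objective A) (StiefelSync.Stiefel (2 ^ d * p) d p) R →
                R * Rᵀ = Z * Zᵀ) := by
  refine ⟨fun n A Z hZ hL hLZ hpos hratio S _ hZS =>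
    StiefelSync.not_isSecondOrderCritical_of_condition_number hd hp hZ hL hLZ hpos hratio hZS, ?_⟩
  intro Z hZ S L hS hL
  have hT := StiefelSync.isBalanced_twistedBlock hd hp
  have hblock : ∀ i, StiefelSync.block S i =
      StiefelSync.block Z i * StiefelSync.twistedBlock d p i := fun i => by
    rw [hS]
    rfl
  have h2 : 2 ≤ 2 ^ d * p := by
    calc 2 = 2 ^ 1 * 1 := rfl
      _ ≤ 2 ^ d * p := Nat.mul_le_mul (Nat.pow_le_pow_right (by norm_num) hd) (hd.trans hp)
  have hn : 0 < 2 ^ d * p := by omega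
  have hp0 : 0 < p := by omega
  have hZS := hT.transpose_mul hZ hblock
  have hLZ := StiefelSync.twistedLaplacian_mul_self hn hZ hZS
  have hmax := hT.maxEigenvalue_eq h2 hd hp hZ hblock
    (StiefelSync.add_lt_two_pow_mul_or_ratio_eq_one hd hp)
  have hkth := hT.kthEigenvalue_eq_one h2 hd hp hZ hblock
  subst hL
  refine ⟨hT.mem_stiefel hZ hblock, hZS, hT.posSemidef hn hd hp0 hZ hblock, hLZ, hmax, hkth, ?_,
    StiefelSync.certificate_neg hLZ, fun A hA => ⟨hT.isSecondOrderCritical hn hd hp hZ hblock hA,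
      StiefelSync.mul_frame_mem_stiefel hp hZ, hT.isMinOn hn hd hp hZ hblock hA,
      fun R hR hmin => hT.mul_transpose_of_isMinOn hn hd hp hZ hblock hA hR hmin⟩⟩
  rw [hmax, hkth, div_one]
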